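/- Let $\ell\in\mathbb{N}_0$, $m=2\ell+1$, and let $D: SO(3)\to U(m)$ be a (continuous) irreducible unitary representation of the rotation group on $\mathbb{C}^m$. Let $$H^1_\rho=\{u\in H^1(\mathbb{R}^3,\mathbb{C}^m): D(R)\,u(R^{-1}x)=u(x)\ \text{for a.e. }x\in\mathbb{R}^3,\ \text{for every } R\in SO(3)\},$$ a closed subspace of $H^1(\mathbb{R}^3,\mathbb{C}^m)$, with the norm $\|u\|_{H^1}^2=\|u\|_2^2+\sum_{j=1}^3\|\partial_j u\|_2^2$. Let $V:\mathbb{R}^3\to\mathbb{R}$ be measurable with $V\in L^2_{\rm loc}(\mathbb{R}^3)$, $V(x)\to 0$ as $|x|\to\infty$, and $V\le 0$. For $u\in H^1(\mathbb{R}^3,\mathbb{C}^m)$ put $$\mathcal{E}[u]=\frac12\int_{\mathbb{R}^3}|\nabla u|^2\,dx+\frac12\int_{\mathbb{R}^3}V|u|^2\,dx-\frac1{16\pi}\int_{\mathbb{R}^3}\int_{\mathbb{R}^3}\frac{|u(x)|^2|u(y)|^2}{|x-y|}\,dx\,dy .$$ For $N>0$ let $\mathcal{A}_{\rho,N}=\{u\in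 H^1_\rho:\|u\|_2^2=N\}$ and $E_\ell(N)=\inf\{\mathcal{E}[u]:u\in\mathcal{A}_{\rho,N}\}$. Suppose $(u_k)$ is a sequence in $\mathcal{A}_{\rho,N}$ with $\mathcal{E}[u_k]\to E_\ell(N)$ which converges weakly in $H^1_\rho$ to some $u_*\in H^1_\rho$. Then (a) $\|u_*\|_2^2=N$, that is, $u_*\in\mathcal{A}_{\rho,N}$; (b) $u_*$ is a minimizer: $\mathcal{E}[u_*]=E_\ell(N)\le\mathcal{E}[v]$ for all $v\in\mathcal{A}_{\rho,N}$; (c) $u_k\to u_*$ strongly in $H^1_\rho$. In particular, every minimizing sequence, i.e. every sequence $(u_k)$ in $\mathcal{A}_{\rho,N}$ with $\mathcal{E}[u_k]\to E_\ell(N)$ (not assumed to converge weakly), is relatively compact: the set $\{u_k : k\in\mathbb{N}\}$ has compact closure in $H^1_\rho$. -/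

import Mathlib

open MeasureTheory Filter Topology
open scoped ContDiff

noncomputable section

namespace BosonStar

/-- The Euclidean space `ℝ³`. -/
abbrev E3 : Type := EuclideanSpace ℝ (Fin 3)

/-- The Hermitian space `ℂᵐ`. -/
abbrev Cm (m : ℕ) : Type := EuclideanSpace ℂ (Fin m)

/-- The rotation group `SO(3)`. -/
abbrev SO3 : Type := Matrix.specialOrthogonalGroup (Fin 3) ℝ

/-- The complex Hilbert space `L²(ℝ³, ℂᵐ)` (classes of functions modulo null sets). -/
abbrev L2 (m : ℕ) : Type := Lp (Cm m) 2 (volume : Measure E3)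

/-- `g` is the weak gradient of `u`: for all real test functions `φ ∈ C_c^∞(ℝ³)` and all `j`,
`∫ (∂ⱼφ) u = - ∫ φ gⱼ`. -/
def IsWeakGradient {m : ℕ} (u : L2 m) (g : Fin 3 → L2 m) : Prop :=
  ∀ φ : E3 → ℝ, ContDiff ℝ ∞ φ → HasCompactSupport φ → ∀ j : Fin 3,
    ∫ x, (fderiv ℝ φ x (EuclideanSpace.single j 1)) • (u x) = - ∫ x, φ x • (g j x)

/-- A continuous compactly supported scalar function times an `L²` function is integrable. -/
theorem integrable_smul_L2 {m : ℕ} {φ : E3 → ℝ} (hc : Continuous φ) (hs : HasCompactSupport φ)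
    (u : L2 m) : Integrable (fun x => φ x • u x) := by
  have h1 : MemLp φ 2 (volume : Measure E3) := hc.memLp_of_hasCompactSupport hs
  have h2 : MemLp (fun x => φ x • u x) 1 (volume : Measure E3) := (Lp.memLp u).smul h1
  exact memLp_one_iff_integrable.1 h2

theorem integrable_fderiv_smul_L2 {m : ℕ} {φ : E3 → ℝ} (hc : ContDiff ℝ ∞ φ)
    (hs : HasCompactSupport φ) (j : Fin 3) (u : L2 m) :
    Integrable (fun x => (fderiv ℝ φ x (EuclideanSpace.single j 1)) • u x) := by
  refine integrable_smul_L2 ?_ ?_ u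
  · exact (hc.continuous_fderiv (by simp)).clm_apply continuous_const
  · exact hs.fderiv_apply (𝕜 := ℝ) (v := EuclideanSpace.single j 1)

/-- The Hilbert space of pairs `(u, g)` with `u ∈ L²(ℝ³, ℂᵐ)` and `g ∈ (L²(ℝ³, ℂᵐ))³`, with the norm
`(‖u‖₂² + ∑ⱼ ‖gⱼ‖₂²)^{1/2}`. -/
abbrev Pairs (m : ℕ) : Type := WithLp 2 (L2 m × PiLp 2 (fun _ : Fin 3 => L2 m))

/-- The Sobolev space `H¹(ℝ³, ℂᵐ)`. An element is a function `u ∈ L²` together with its weak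
gradient `(∂₁u, ∂₂u, ∂₃u) ∈ (L²)³` (which `u` determines). The norm of pairs is exactly
`‖u‖_{H¹} = (‖u‖₂² + ∑ⱼ ‖∂ⱼu‖₂²)^{1/2}`. -/
def H1 (m : ℕ) : Submodule ℂ (Pairs m) where
  carrier := {p | IsWeakGradient p.fst (fun j => p.snd j)}
  zero_mem' := by
    intro φ hφ hs j
    have e1 : ∫ x, (fderiv ℝ φ x (EuclideanSpace.single j 1)) • ((0 : L2 m) x) = 0 := by simp
    have e2 : ∫ x, φ x • ((0 : L2 m) x) = 0 := by simp
    change ∫ x, (fderiv ℝ φ x (EuclideanSpace.single j 1)) • ((0 : L2 m) x)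
      = - ∫ x, φ x • ((0 : L2 m) x)
    rw [e1, e2, neg_zero]
  add_mem' := by
    intro p q hp hq φ hφ hs j
    have e1 : ∫ x, (fderiv ℝ φ x (EuclideanSpace.single j 1)) • ((p.fst + q.fst : L2 m) x)
        = (∫ x, (fderiv ℝ φ x (EuclideanSpace.single j 1)) • (p.fst x))
          + ∫ x, (fderiv ℝ φ x (EuclideanSpace.single j 1)) • (q.fst x) := by
      rw [← integral_add (integrable_fderiv_smul_L2 hφ hs j _)
        (integrable_fderiv_smul_L2 hφ hs j _)]
      refine integral_congr_ae ?_
      filter_upwards [Lp.coeFn_add p.fst q.fst] with x hx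
      simp only [hx, Pi.add_apply, smul_add]
    have e2 : ∫ x, φ x • ((p.snd j + q.snd j : L2 m) x)
        = (∫ x, φ x • (p.snd j x)) + ∫ x, φ x • (q.snd j x) := by
      rw [← integral_add (integrable_smul_L2 hφ.continuous hs _)
        (integrable_smul_L2 hφ.continuous hs _)]
      refine integral_congr_ae ?_
      filter_upwards [Lp.coeFn_add (p.snd j) (q.snd j)] with x hx
      simp only [hx, Pi.add_apply, smul_add]
    change ∫ x, (fderiv ℝ φ x (EuclideanSpace.single j 1)) • ((p.fst + q.fst : L2 m) x)
      = - ∫ x, φ x • ((p.snd j + q.snd j : L2 m) x)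
    rw [e1, e2, hp φ hφ hs j, hq φ hφ hs j]
    abel
  smul_mem' := by
    intro c p hp φ hφ hs j
    have e1 : ∫ x, (fderiv ℝ φ x (EuclideanSpace.single j 1)) • ((c • p.fst : L2 m) x)
        = c • ∫ x, (fderiv ℝ φ x (EuclideanSpace.single j 1)) • (p.fst x) := by
      rw [← integral_smul]
      refine integral_congr_ae ?_
      filter_upwards [Lp.coeFn_smul c p.fst] with x hx
      simp only [hx, Pi.smul_apply]
      exact smul_comm _ _ _
    have e2 : ∫ x, φ x • ((c • p.snd j : L2 m) x) = c • ∫ x, φ x • (p.snd j x) := by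
      rw [← integral_smul]
      refine integral_congr_ae ?_
      filter_upwards [Lp.coeFn_smul c (p.snd j)] with x hx
      simp only [hx, Pi.smul_apply]
      exact smul_comm _ _ _
    change ∫ x, (fderiv ℝ φ x (EuclideanSpace.single j 1)) • ((c • p.fst : L2 m) x)
      = - ∫ x, φ x • ((c • p.snd j : L2 m) x)
    rw [e1, e2, hp φ hφ hs j, smul_neg]

/-- The function underlying an element of `H¹`. -/
def toL2 {m : ℕ} (u : H1 m) : L2 m := (u : Pairs m).fst

/-- The weak partial derivative `∂ⱼu` of an element of `H¹`. -/
def partialDeriv {m : ℕ} (u : H1 m) (j : Fin 3) : L2 m :=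
  (u : Pairs m).snd j

/-- The rotation `x ↦ R x` of `ℝ³`. -/
def rotate (R : SO3) : E3 → E3 := fun x => Matrix.toEuclideanCLM (n := Fin 3) (𝕜 := ℝ) R.1 x

theorem measurePreserving_rotate (R : SO3) :
    MeasurePreserving (rotate R) (volume : Measure E3) volume := by
  have h : R.1 ∈ unitary (Matrix (Fin 3) (Fin 3) ℝ) :=
    (Matrix.mem_specialOrthogonalGroup_iff.1 R.2).1
  have h' : Matrix.toEuclideanCLM (n := Fin 3) (𝕜 := ℝ) R.1 ∈ unitary (E3 →L[ℝ] E3) :=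
    Unitary.map_mem _ h
  exact (Unitary.linearIsometryEquiv ⟨_, h'⟩).measurePreserving

/-- The operator `D(R)` on `ℂᵐ` given by a unitary matrix representation `D` of `SO(3)`. -/
def valueAction {m : ℕ} (D : SO3 →* Matrix.unitaryGroup (Fin m) ℂ) (R : SO3) : Cm m →L[ℂ] Cm m :=
  Matrix.toEuclideanCLM (n := Fin m) (𝕜 := ℂ) (D R).1

/-- A unitary matrix representation of `SO(3)` as a linear representation on `ℂᵐ`. -/
def linearRep {m : ℕ} (D : SO3 →* Matrix.unitaryGroup (Fin m) ℂ) :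
    Representation ℂ SO3 (Cm m) where
  toFun R := (valueAction D R).toLinearMap
  map_one' := by
    simp [valueAction]
  map_mul' R S := by
    simp [valueAction]

/-- The unitary operator `[ρ(R)u](x) = D(R) u(R⁻¹x)` on `L²(ℝ³, ℂᵐ)`. -/
def rho {m : ℕ} (D : SO3 →* Matrix.unitaryGroup (Fin m) ℂ) (R : SO3) : L2 m →ₗ[ℂ] L2 m :=
  (ContinuousLinearMap.compLpₗ 2 (volume : Measure E3) (valueAction D R)) ∘ₗ
    (Lp.compMeasurePreservingₗ ℂ (rotate R⁻¹) (measurePreserving_rotate R⁻¹))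

/-- The pointwise formula for `ρ(R)u`. -/
theorem rho_ae_eq {m : ℕ} (D : SO3 →* Matrix.unitaryGroup (Fin m) ℂ) (R : SO3) (u : L2 m) :
    (rho D R u : E3 → Cm m) =ᵐ[volume] fun x => valueAction D R (u (rotate R⁻¹ x)) := by
  have h1 := ContinuousLinearMap.coeFn_compLp (valueAction D R)
    (Lp.compMeasurePreserving (rotate R⁻¹) (measurePreserving_rotate R⁻¹) u)
  have h2 := Lp.coeFn_compMeasurePreserving u (measurePreserving_rotate R⁻¹)
  filter_upwards [h1, h2] with x hx1 hx2
  rw [hx2] at hx1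
  exact hx1

/-- `H¹_ρ`: the `u ∈ H¹(ℝ³, ℂᵐ)` with `ρ(R)u = u` for all `R ∈ SO(3)`, with the norm of `H¹`. -/
def H1rho {m : ℕ} (D : SO3 →* Matrix.unitaryGroup (Fin m) ℂ) : Submodule ℂ (Pairs m) where
  carrier := {p | p ∈ H1 m ∧ ∀ R : SO3, rho D R p.fst = p.fst}
  zero_mem' := ⟨(H1 m).zero_mem, fun R => map_zero (rho D R)⟩
  add_mem' := by
    intro p q hp hq
    refine ⟨(H1 m).add_mem hp.1 hq.1, fun R => ?_⟩
    change rho D R (p.fst + q.fst) = p.fst + q.fst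
    rw [map_add, hp.2 R, hq.2 R]
  smul_mem' := by
    intro c p hp
    refine ⟨(H1 m).smul_mem c hp.1, fun R => ?_⟩
    change rho D R (c • p.fst) = c • p.fst
    rw [map_smul, hp.2 R]

/-- The inclusion `H¹_ρ ⊆ H¹`. -/
def toH1 {m : ℕ} {D : SO3 →* Matrix.unitaryGroup (Fin m) ℂ} (u : H1rho D) : H1 m :=
  ⟨(u : Pairs m), u.2.1⟩

/-- The kinetic energy `T[u] = ½ ∫ |∇u|²`. -/
def kinetic {m : ℕ} (u : H1 m) : ℝ :=
  (1 / 2) * ∫ x, ∑ j, ‖partialDeriv u j x‖ ^ 2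

/-- `L[n] = ½ ∫ (-V(x)) n(x) dx`. -/
def external (V : E3 → ℝ) (n : E3 → ℝ) : ℝ :=
  (1 / 2) * ∫ x, (-V x) * n x

/-- `D[n] = 1/(16π) ∬ n(x) n(y) / |x - y| dx dy`. -/
def selfGravity (n : E3 → ℝ) : ℝ :=
  (1 / (16 * Real.pi)) * ∫ x, ∫ y, n x * n y / ‖x - y‖

/-- The density `n = |u|²`. -/
def density {m : ℕ} (u : H1 m) : E3 → ℝ := fun x => ‖toL2 u x‖ ^ 2

/-- The total energy `ℰ[u] = T[u] - L[|u|²] - D[|u|²]`. -/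
def energy {m : ℕ} (V : E3 → ℝ) (u : H1 m) : ℝ :=
  kinetic u - external V (density u) - selfGravity (density u)

/-- The constraint set `{u ∈ H¹_ρ : ‖u‖₂² = N}`. -/
def admissible {m : ℕ} (D : SO3 →* Matrix.unitaryGroup (Fin m) ℂ) (N : ℝ) : Set (H1rho D) :=
  {u | ‖toL2 (toH1 u)‖ ^ 2 = N}

/-- `E_ℓ(N) = inf {ℰ[u] : u ∈ H¹_ρ, ‖u‖₂² = N}`. -/
def minEnergy {m : ℕ} (D : SO3 →* Matrix.unitaryGroup (Fin m) ℂ) (V : E3 → ℝ) (N : ℝ) : ℝ :=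
  sInf ((fun u : H1rho D => energy V (toH1 u)) '' admissible D N)

/-- A minimizing sequence for `E_ℓ(N)`. -/
def IsMinimizingSeq {m : ℕ} (D : SO3 →* Matrix.unitaryGroup (Fin m) ℂ) (V : E3 → ℝ) (N : ℝ)
    (u : ℕ → H1rho D) : Prop :=
  (∀ k, u k ∈ admissible D N) ∧
    Tendsto (fun k => energy V (toH1 (u k))) atTop (𝓝 (minEnergy D V N))

end BosonStar

end

noncomputable section

namespace BosonStar

open scoped ENNReal NNReal Convolution


/-! This is the direct method, with rotational symmetry supplying the missing compactness. On the
constraint set the two attractive terms are dominated by a small multiple of the kinetic energy plus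
a constant (`exists_gradSq_le_energy`), so minimizing sequences are bounded in `H¹`.

Both attractive terms are continuous along bounded weakly convergent sequences. For the external
term, `V` is small at infinity and the densities converge in `L¹` on balls by Rellich
(`tendsto_external`). For self-gravity, the density is rotation invariant because `D(R)` is unitary.
A far ball therefore has many disjoint rotated copies of equal mass, so it carries little mass, and
the Newton potential is small far from the origin, uniformly on bounded sets
(`setIntegral_ball_le_of_invariant`, `exists_newtonPotential_le_of_far`). Mass escaping to infinity
thus contributes nothing in the limit (`tendsto_selfGravity`).

Since the kinetic term is weakly lower semicontinuous, the weak limit has energy at most the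
infimum. The infimum is negative: under mass preserving dilation by a small factor `l`, kinetic
energy scales like `l²` and self-gravity only like `l` (`minEnergy_neg`). If the limit had lost
mass, increasing its amplitude up to mass `N` would bring the energy strictly below the infimum
(`le_norm_sq_of_energy_le`). So no mass is lost, the limit is a minimizer, the kinetic energies
converge, and weak convergence with convergence of norms is strong. Relative compactness follows
from weak sequential compactness of bounded sets in the separable Hilbert space `H¹_ρ`. -/

/-! ### Averages and mollification -/

theorem sq_lintegral_le_lintegral_sq {Y : Type*} [MeasurableSpace Y] {ν : Measure Y}
    [IsProbabilityMeasure ν] {f : Y → ℝ≥0∞} (hf : AEMeasurable f ν) :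
    (∫⁻ t, f t ∂ν) ^ 2 ≤ ∫⁻ t, f t ^ 2 ∂ν := by
  have h := ENNReal.lintegral_mul_le_Lp_mul_Lq ν Real.HolderConjugate.two_two hf
    (aemeasurable_const (b := (1 : ℝ≥0∞)))
  simp only [Pi.mul_apply, mul_one, lintegral_const, measure_univ,
    ENNReal.rpow_ofNat, one_pow, ENNReal.one_rpow] at h
  calc (∫⁻ t, f t ∂ν) ^ 2 ≤ ((∫⁻ t, f t ^ 2 ∂ν) ^ (1 / 2 : ℝ)) ^ 2 := by gcongr
    _ = ∫⁻ t, f t ^ 2 ∂ν := by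
      rw [← ENNReal.rpow_natCast, ← ENNReal.rpow_mul]; norm_num

/-- The square of an average is controlled by the average of the squares, integrated. -/
theorem lintegral_enorm_integral_sq_le {X Y E : Type*} [MeasurableSpace X] [MeasurableSpace Y]
    [NormedAddCommGroup E] [NormedSpace ℝ E] {μ : Measure X} [SFinite μ] {ν : Measure Y}
    [IsProbabilityMeasure ν] {F : X → Y → E} (hF : StronglyMeasurable (Function.uncurry F)) :
    ∫⁻ x, ‖∫ t, F x t ∂ν‖ₑ ^ 2 ∂μ ≤ ∫⁻ t, ∫⁻ x, ‖F x t‖ₑ ^ 2 ∂μ ∂ν := by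
  calc ∫⁻ x, ‖∫ t, F x t ∂ν‖ₑ ^ 2 ∂μ ≤ ∫⁻ x, ∫⁻ t, ‖F x t‖ₑ ^ 2 ∂ν ∂μ := by
        refine lintegral_mono fun x => ?_
        calc ‖∫ t, F x t ∂ν‖ₑ ^ 2 ≤ (∫⁻ t, ‖F x t‖ₑ ∂ν) ^ 2 := by
              gcongr; exact enorm_integral_le_lintegral_enorm _
          _ ≤ _ := sq_lintegral_le_lintegral_sq
            (hF.comp_measurable measurable_prodMk_left).enorm.aemeasurable
    _ = _ := lintegral_lintegral_swap (hF.enorm.pow_const 2).aemeasurable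

/-- The mollification of `u` by a normed bump function. -/
def mollify {E : Type*} [NormedAddCommGroup E] [NormedSpace ℝ E] (φ : ContDiffBump (0 : E3))
    (u : E3 → E) : E3 → E :=
  φ.normed volume ⋆[ContinuousLinearMap.lsmul ℝ ℝ, volume] u

/-- The probability measure with density a normed bump function. -/
def bumpMeasure (φ : ContDiffBump (0 : E3)) : Measure E3 :=
  volume.withDensity fun y => ((φ.normed volume y).toNNReal : ℝ≥0∞)

theorem measurable_bump (φ : ContDiffBump (0 : E3)) :
    Measurable fun y => (φ.normed (volume : Measure E3) y).toNNReal :=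
  (φ.continuous_normed.measurable).real_toNNReal

instance (φ : ContDiffBump (0 : E3)) : IsProbabilityMeasure (bumpMeasure φ) := by
  constructor
  rw [bumpMeasure, withDensity_apply _ MeasurableSet.univ, Measure.restrict_univ]
  have h := ofReal_integral_eq_lintegral_ofReal (μ := (volume : Measure E3)) φ.integrable_normed
    (Eventually.of_forall φ.nonneg_normed)
  rw [φ.integral_normed, ENNReal.ofReal_one] at h
  exact h.symm

theorem integral_bumpMeasure {E : Type*} [NormedAddCommGroup E] [NormedSpace ℝ E]
    (φ : ContDiffBump (0 : E3)) (f : E3 → E) :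
    ∫ t, f t ∂(bumpMeasure φ) = ∫ t, φ.normed volume t • f t := by
  rw [bumpMeasure, integral_withDensity_eq_integral_smul (measurable_bump φ)]
  refine integral_congr_ae (Eventually.of_forall fun t => ?_)
  simp only [NNReal.smul_def, Real.coe_toNNReal _ (φ.nonneg_normed t)]

theorem mollify_apply {E : Type*} [NormedAddCommGroup E] [NormedSpace ℝ E]
    (φ : ContDiffBump (0 : E3)) (u : E3 → E) (x : E3) :
    mollify φ u x = ∫ t, u (x - t) ∂(bumpMeasure φ) := by
  rw [integral_bumpMeasure]; rfl

theorem bumpMeasure_ball (φ : ContDiffBump (0 : E3)) : ∀ᵐ t ∂(bumpMeasure φ), ‖t‖ ≤ φ.rOut := by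
  rw [bumpMeasure, ae_withDensity_iff (measurable_bump φ).coe_nnreal_ennreal]
  refine Eventually.of_forall fun t ht => ?_
  have : t ∈ Function.support (φ.normed (volume : Measure E3)) := by
    intro h0; apply ht; simp [h0]
  rw [φ.support_normed_eq] at this
  simpa using (Metric.mem_ball.1 this).le

/-- Mollification averages translates of `u` against a probability measure, and translation
preserves the integral. -/
theorem lintegral_mollify_sq_le {E : Type*} [NormedAddCommGroup E] [NormedSpace ℝ E]
    (φ : ContDiffBump (0 : E3)) {u : E3 → E} (hu : StronglyMeasurable u) :
    ∫⁻ x, ‖mollify φ u x‖ₑ ^ 2 ≤ ∫⁻ x, ‖u x‖ₑ ^ 2 := by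
  simp only [mollify_apply]
  have hm : StronglyMeasurable (Function.uncurry fun x t : E3 => u (x - t)) :=
    hu.comp_measurable (measurable_fst.sub measurable_snd)
  refine (lintegral_enorm_integral_sq_le hm).trans ?_
  have : ∀ t : E3, ∫⁻ x, ‖u (x - t)‖ₑ ^ 2 = ∫⁻ x, ‖u x‖ₑ ^ 2 := fun t =>
    lintegral_sub_right_eq_self (fun x => ‖u x‖ₑ ^ 2) t
  simp [this]

/-! ### Mollification and weak gradients -/

variable {m : ℕ}

theorem locallyIntegrable_L2 (u : L2 m) : LocallyIntegrable u volume :=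
  (Lp.memLp u).locallyIntegrable (by norm_num)

theorem contDiff_mollify (φ : ContDiffBump (0 : E3)) (u : L2 m) : ContDiff ℝ 1 (mollify φ u) :=
  φ.hasCompactSupport_normed.contDiff_convolution_left _ (n := 1)
    φ.contDiff_normed (locallyIntegrable_L2 u)

/-- The weak gradient is tested against `y ↦ φ (x - y)`. The sign from the reflection cancels the
sign in the definition of weak gradient. -/
theorem fderiv_mollify (φ : ContDiffBump (0 : E3)) {u : L2 m} {g : Fin 3 → L2 m}
    (h : IsWeakGradient u g) (x : E3) (j : Fin 3) :
    fderiv ℝ (mollify φ u) x (EuclideanSpace.single j 1) = mollify φ (g j) x := by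
  have hd := φ.hasCompactSupport_normed.hasFDerivAt_convolution_left
    (ContinuousLinearMap.lsmul ℝ ℝ : ℝ →L[ℝ] Cm m →L[ℝ] Cm m)
    (φ.contDiff_normed (n := 1) (μ := (volume : Measure E3))) (locallyIntegrable_L2 u) x
  have hd' : HasFDerivAt (mollify φ u) _ x := hd
  rw [hd'.fderiv]
  have hψ : ContDiff ℝ ∞ fun y => φ.normed (volume : Measure E3) (x - y) :=
    (φ.contDiff_normed).comp (contDiff_const.sub contDiff_id)
  have hs : HasCompactSupport fun y => φ.normed (volume : Measure E3) (x - y) :=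
    φ.hasCompactSupport_normed.comp_homeomorph (Homeomorph.subLeft x)
  have hw := h _ hψ hs j
  have hfd : ∀ y, fderiv ℝ (fun y => φ.normed (volume : Measure E3) (x - y)) y
      (EuclideanSpace.single j 1) =
      - fderiv ℝ (φ.normed (volume : Measure E3)) (x - y) (EuclideanSpace.single j 1) := by
    intro y
    have h1 : HasFDerivAt (φ.normed (volume : Measure E3)) _ (x - y) :=
      ((φ.contDiff_normed (n := 1)).differentiable one_ne_zero (x - y)).hasFDerivAt
    have h2 := h1.comp y ((hasFDerivAt_const x y).sub (hasFDerivAt_id y))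
    have h3 : HasFDerivAt (fun y => φ.normed (volume : Measure E3) (x - y)) _ y := h2
    rw [h3.fderiv]
    simp
  simp only [hfd, neg_smul, integral_neg, neg_inj] at hw
  have hint : ConvolutionExistsAt (fderiv ℝ (φ.normed (volume : Measure E3))) u x
      ((ContinuousLinearMap.lsmul ℝ ℝ : ℝ →L[ℝ] Cm m →L[ℝ] Cm m).precompL E3) volume :=
    (φ.hasCompactSupport_normed.fderiv ℝ).convolutionExists_left _
      ((φ.contDiff_normed (n := 1)).continuous_fderiv one_ne_zero) (locallyIntegrable_L2 u) x
  rw [convolution, ContinuousLinearMap.integral_apply hint]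
  rw [mollify, convolution_eq_swap, ← integral_sub_left_eq_self _ volume x]
  simp only [ContinuousLinearMap.precompL_apply, ContinuousLinearMap.lsmul_apply, sub_sub_cancel]
  exact hw

theorem enorm_sq_le_sum (L : E3 →L[ℝ] Cm m) :
    ‖L‖ₑ ^ 2 ≤ ∑ j, ‖L (EuclideanSpace.single j 1)‖ₑ ^ 2 := by
  have h : ‖L‖ ≤ Real.sqrt (∑ j, ‖L (EuclideanSpace.single j 1)‖ ^ 2) := by
    refine L.opNorm_le_bound (Real.sqrt_nonneg _) fun x => ?_
    have hx : x = ∑ j, x j • EuclideanSpace.single j (1 : ℝ) := by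
      ext i; simp [Pi.single_apply]
    calc ‖L x‖ = ‖∑ j, x j • L (EuclideanSpace.single j 1)‖ := by
          conv_lhs => rw [hx]
          simp only [map_sum, map_smul]
      _ ≤ ∑ j, ‖L (EuclideanSpace.single j 1)‖ * ‖x j‖ := by
          refine (norm_sum_le _ _).trans (Finset.sum_le_sum fun j _ => ?_)
          rw [norm_smul, mul_comm]
      _ ≤ _ := by
          rw [EuclideanSpace.norm_eq]
          exact Real.sum_mul_le_sqrt_mul_sqrt _ _ _
  have h2 : ‖L‖ ^ 2 ≤ ∑ j, ‖L (EuclideanSpace.single j 1)‖ ^ 2 :=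
    (Real.le_sqrt (norm_nonneg _) (Finset.sum_nonneg fun _ _ => by positivity)).1 h
  have h3 := ENNReal.ofReal_le_ofReal h2
  rw [ENNReal.ofReal_sum_of_nonneg (fun _ _ => by positivity)] at h3
  simpa only [ENNReal.ofReal_pow (norm_nonneg _), ofReal_norm] using h3

theorem lintegral_fderiv_mollify_le (φ : ContDiffBump (0 : E3)) {u : L2 m} {g : Fin 3 → L2 m}
    (h : IsWeakGradient u g) :
    ∫⁻ x, ‖fderiv ℝ (mollify φ u) x‖ₑ ^ 2 ≤ ∑ j, ∫⁻ x, ‖g j x‖ₑ ^ 2 := by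
  have hc : ∀ j, Measurable fun x => ‖mollify φ (g j) x‖ₑ ^ 2 := fun j =>
    (contDiff_mollify φ (g j)).continuous.measurable.enorm.pow_const 2
  calc ∫⁻ x, ‖fderiv ℝ (mollify φ u) x‖ₑ ^ 2
      ≤ ∫⁻ x, ∑ j, ‖mollify φ (g j) x‖ₑ ^ 2 := by
        refine lintegral_mono fun x => (enorm_sq_le_sum _).trans_eq ?_
        simp only [fderiv_mollify φ h]
    _ = ∑ j, ∫⁻ x, ‖mollify φ (g j) x‖ₑ ^ 2 := lintegral_finsetSum _ fun j _ => hc j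
    _ ≤ _ := Finset.sum_le_sum fun j _ => lintegral_mollify_sq_le φ (Lp.stronglyMeasurable _)

/-! ### Translation estimates and the mollification error -/

/-- The increment is the average over `t ∈ (0,1]` of the derivative along the segment, and each of
these derivatives is a translate in `x`. -/
theorem lintegral_translate_sub_sq_le_of_contDiff {w : E3 → Cm m} (hw : ContDiff ℝ 1 w) (y : E3) :
    ∫⁻ x, ‖w (x - y) - w x‖ₑ ^ 2 ≤ ‖y‖ₑ ^ 2 * ∫⁻ x, ‖fderiv ℝ w x‖ₑ ^ 2 := by
  have hcf : Continuous (fderiv ℝ w) := hw.continuous_fderiv one_ne_zero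
  let ν : Measure ℝ := volume.restrict (Set.Ioc (0 : ℝ) 1)
  have : IsProbabilityMeasure ν := ⟨by simp [ν]⟩
  have hftc : ∀ x, w (x - y) - w x = ∫ t, fderiv ℝ w (x - t • y) (-y) ∂ν := by
    intro x
    have hder : ∀ t : ℝ, HasDerivAt (fun t : ℝ => w (x - t • y))
        (fderiv ℝ w (x - t • y) (-y)) t := by
      intro t
      have h1 : HasFDerivAt w (fderiv ℝ w (x - t • y)) (x - t • y) :=
        (hw.differentiable one_ne_zero _).hasFDerivAt
      have h2 : HasDerivAt (fun t : ℝ => x - t • y) (-y) t := by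
        simpa using ((hasDerivAt_id t).smul_const y).const_sub x
      exact h1.comp_hasDerivAt t h2
    have := intervalIntegral.integral_eq_sub_of_hasDerivAt (a := 0) (b := 1)
      (fun t _ => hder t) (Continuous.intervalIntegrable (by fun_prop) _ _)
    rw [intervalIntegral.integral_of_le zero_le_one] at this
    simp only [one_smul, zero_smul, sub_zero] at this
    exact this.symm
  simp only [hftc]
  have hm : StronglyMeasurable (Function.uncurry fun (x : E3) (t : ℝ) =>
      fderiv ℝ w (x - t • y) (-y)) := by
    apply Continuous.stronglyMeasurable
    simp only [Function.uncurry_def]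
    fun_prop
  refine (lintegral_enorm_integral_sq_le hm).trans ?_
  calc ∫⁻ t, (∫⁻ x, ‖fderiv ℝ w (x - t • y) (-y)‖ₑ ^ 2) ∂ν
      ≤ ∫⁻ _t, (‖y‖ₑ ^ 2 * ∫⁻ x, ‖fderiv ℝ w x‖ₑ ^ 2) ∂ν := by
        refine lintegral_mono fun t => ?_
        rw [← lintegral_sub_right_eq_self (fun x => ‖fderiv ℝ w x‖ₑ ^ 2) (t • y),
          ← lintegral_const_mul _ (by fun_prop)]
        refine lintegral_mono fun x => ?_
        calc _ ≤ (‖fderiv ℝ w (x - t • y)‖ₑ * ‖-y‖ₑ) ^ 2 := by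
              gcongr; exact ContinuousLinearMap.le_opENorm _ _
          _ = _ := by rw [enorm_neg, mul_pow, mul_comm]
    _ = _ := by simp

/-- Bump functions shrinking to the origin. -/
def shrinkingBump (k : ℕ) : ContDiffBump (0 : E3) where
  rIn := 1 / (2 * (k + 1))
  rOut := 1 / (k + 1)
  rIn_pos := by positivity
  rIn_lt_rOut := by
    apply one_div_lt_one_div_of_lt
    · positivity
    · have : (0 : ℝ) < k + 1 := by positivity
      linarith

theorem tendsto_shrinkingBump_rOut : Tendsto (fun k => (shrinkingBump k).rOut) atTop (𝓝 0) :=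
  tendsto_one_div_add_atTop_nhds_zero_nat

theorem ae_tendsto_mollify (u : L2 m) :
    ∀ᵐ x, Tendsto (fun k => mollify (shrinkingBump k) u x) atTop (𝓝 (u x)) := by
  -- `K = 2` is the ratio `rOut / rIn` of the bumps; its boundedness is what Lebesgue
  -- differentiation needs.
  refine ContDiffBump.ae_convolution_tendsto_right_of_locallyIntegrable (K := 2)
    tendsto_shrinkingBump_rOut (Eventually.of_forall fun k => ?_) (locallyIntegrable_L2 u)
  simp only [shrinkingBump]
  have : (0 : ℝ) < k + 1 := by positivity
  field_simp
  exact le_rfl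

/-- Fatou carries the smooth estimate over from the mollifications, whose gradients are controlled
by `g`. -/
theorem lintegral_translate_sub_sq_le {u : L2 m} {g : Fin 3 → L2 m}
    (h : IsWeakGradient u g) (y : E3) :
    ∫⁻ x, ‖u (x - y) - u x‖ₑ ^ 2 ≤ ‖y‖ₑ ^ 2 * ∑ j, ∫⁻ x, ‖g j x‖ₑ ^ 2 := by
  have hae := ae_tendsto_mollify u
  have hae' : ∀ᵐ x, Tendsto (fun k => mollify (shrinkingBump k) u (x - y)) atTop
      (𝓝 (u (x - y))) :=
    (measurePreserving_sub_right volume y).quasiMeasurePreserving.ae hae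
  calc ∫⁻ x, ‖u (x - y) - u x‖ₑ ^ 2
      = ∫⁻ x, liminf (fun k => ‖mollify (shrinkingBump k) u (x - y)
          - mollify (shrinkingBump k) u x‖ₑ ^ 2) atTop := by
        refine lintegral_congr_ae ?_
        filter_upwards [hae, hae'] with x h1 h2
        have h3 := (h2.sub h1).enorm
        have h4 := (ENNReal.continuous_pow 2).tendsto _ |>.comp h3
        exact h4.liminf_eq.symm
    _ ≤ liminf (fun k => ∫⁻ x, ‖mollify (shrinkingBump k) u (x - y)
          - mollify (shrinkingBump k) u x‖ₑ ^ 2) atTop := by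
        refine lintegral_liminf_le fun k => ?_
        have := (contDiff_mollify (shrinkingBump k) u).continuous
        exact Continuous.measurable (by fun_prop)
    _ ≤ liminf (fun _ : ℕ => ‖y‖ₑ ^ 2 * ∑ j, ∫⁻ x, ‖g j x‖ₑ ^ 2) atTop := by
        refine liminf_le_liminf (Eventually.of_forall fun k => ?_)
        refine (lintegral_translate_sub_sq_le_of_contDiff (contDiff_mollify _ u) y).trans ?_
        gcongr
        exact lintegral_fderiv_mollify_le _ h
    _ = _ := by simp

/-- The error is an average of increments over translations of length at most `rOut`. The bound
depends on `u` only through its gradient, which makes the Rellich argument uniform along a sequence.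
-/
theorem lintegral_mollify_sub_sq_le (φ : ContDiffBump (0 : E3)) {u : L2 m} {g : Fin 3 → L2 m}
    (h : IsWeakGradient u g) :
    ∫⁻ x, ‖mollify φ u x - u x‖ₑ ^ 2 ≤ ENNReal.ofReal φ.rOut ^ 2 * ∑ j, ∫⁻ x, ‖g j x‖ₑ ^ 2 := by
  have hu : StronglyMeasurable u := Lp.stronglyMeasurable u
  have hm : StronglyMeasurable (Function.uncurry fun x t : E3 => u (x - t) - u x) :=
    (hu.comp_measurable (measurable_fst.sub measurable_snd)).sub
      (hu.comp_measurable measurable_fst)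
  have he : ∀ x, mollify φ u x - u x = ∫ t, (u (x - t) - u x) ∂(bumpMeasure φ) := by
    intro x
    have hi : Integrable (fun t => u (x - t)) (bumpMeasure φ) := by
      rw [bumpMeasure, integrable_withDensity_iff_integrable_smul (measurable_bump φ)]
      have hce : ConvolutionExistsAt (φ.normed (volume : Measure E3)) u x
          (ContinuousLinearMap.lsmul ℝ ℝ) volume :=
        (φ.hasCompactSupport_normed).convolutionExists_left _
          (φ.continuous_normed) (locallyIntegrable_L2 u) x
      refine hce.congr (Eventually.of_forall fun t => ?_)
      simp [NNReal.smul_def, Real.coe_toNNReal _ (φ.nonneg_normed t)]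
    rw [integral_sub hi (integrable_const _), mollify_apply]
    simp
  simp only [he]
  refine (lintegral_enorm_integral_sq_le hm).trans ?_
  calc _ ≤ ∫⁻ _t, (ENNReal.ofReal φ.rOut ^ 2 * ∑ j, ∫⁻ x, ‖g j x‖ₑ ^ 2) ∂(bumpMeasure φ) := by
        refine lintegral_mono_ae ?_
        filter_upwards [bumpMeasure_ball φ] with t ht
        refine (lintegral_translate_sub_sq_le h t).trans ?_
        gcongr
        rw [← ofReal_norm]
        exact ENNReal.ofReal_le_ofReal ht
    _ = _ := by simp

/-! ### Sobolev embedding into `L⁶` and `L⁴` -/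

/-- A fixed cutoff function equal to `1` on the unit ball. -/
def unitCutoff : ContDiffBump (0 : E3) := ⟨1, 2, one_pos, one_lt_two⟩

/-- The cutoff function at scale `k + 1`. -/
def cutoff (k : ℕ) (x : E3) : ℝ := unitCutoff (((k : ℝ) + 1)⁻¹ • x)

theorem contDiff_cutoff (k : ℕ) : ContDiff ℝ 1 (cutoff k) :=
  unitCutoff.contDiff.comp (contDiff_const_smul _)

theorem cutoff_mem (k : ℕ) (x : E3) : ‖cutoff k x‖ ≤ 1 := by
  rw [cutoff, Real.norm_eq_abs, abs_of_nonneg unitCutoff.nonneg]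
  exact unitCutoff.le_one

theorem hasCompactSupport_cutoff (k : ℕ) : HasCompactSupport (cutoff k) :=
  unitCutoff.hasCompactSupport.comp_smul (inv_ne_zero (by positivity))

theorem tendsto_cutoff (x : E3) : Tendsto (fun k => cutoff k x) atTop (𝓝 1) := by
  have h : Tendsto (fun k : ℕ => ((k : ℝ) + 1)⁻¹ • x) atTop (𝓝 ((0 : ℝ) • x)) := by
    refine Tendsto.smul_const ?_ x
    simpa using tendsto_one_div_add_atTop_nhds_zero_nat (𝕜 := ℝ)
  have h2 := (unitCutoff.continuous.tendsto _).comp h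
  rw [zero_smul, unitCutoff.one_of_mem_closedBall (x := 0) (by simp [unitCutoff])] at h2
  exact h2

theorem exists_norm_fderiv_cutoff_le : ∃ C : ℝ≥0, ∀ k x, ‖fderiv ℝ (cutoff k) x‖ ≤ C := by
  obtain ⟨C, hC⟩ := (unitCutoff.hasCompactSupport.fderiv ℝ).exists_bound_of_continuous
    ((unitCutoff.contDiff (n := 1)).continuous_fderiv one_ne_zero)
  have hC0 : 0 ≤ C := (norm_nonneg _).trans (hC 0)
  refine ⟨⟨C, hC0⟩, fun k x => ?_⟩
  have h1 : fderiv ℝ (cutoff k) x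
      = ((k : ℝ) + 1)⁻¹ • fderiv ℝ unitCutoff (((k : ℝ) + 1)⁻¹ • x) :=
    fderiv_comp_smul (f := unitCutoff) _
  rw [h1, norm_smul]
  have h2 : ‖((k : ℝ) + 1)⁻¹‖ ≤ 1 := by
    rw [norm_inv, Real.norm_of_nonneg (by positivity)]
    exact inv_le_one_of_one_le₀ (by simp)
  calc _ ≤ 1 * C := mul_le_mul h2 (hC _) (norm_nonneg _) zero_le_one
    _ = C := one_mul C

theorem exists_lintegral_pow_six_le_of_contDiff (m : ℕ) : ∃ K : ℝ≥0, ∀ v : E3 → Cm m,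
    ContDiff ℝ 1 v → HasCompactSupport v →
    ∫⁻ x, ‖v x‖ₑ ^ 6 ≤ K * (∫⁻ x, ‖fderiv ℝ v x‖ₑ ^ 2) ^ 3 := by
  refine ⟨SNormLESNormFDerivOfEqConst (Cm m) (volume : Measure E3) 2 ^ 6, fun v hv hs => ?_⟩
  -- In dimension three the Sobolev exponent of `2` is `6`, as `1/6 = 1/2 - 1/3`.
  have h := eLpNorm_le_eLpNorm_fderiv_of_eq (volume : Measure E3) hv hs (p := 2) (p' := 6)
    (by norm_num) (by simp) (by simp; norm_num)
  rw [eLpNorm_nnreal_eq_lintegral (by norm_num), eLpNorm_nnreal_eq_lintegral (by norm_num)] at h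
  have h6 := pow_le_pow_left' h 6
  rw [mul_pow] at h6
  simp only [← ENNReal.rpow_natCast, ← ENNReal.rpow_mul] at h6
  norm_num at h6
  exact_mod_cast h6

/-- Mollifying and cutting off reduces to compactly supported `C¹` functions, and Fatou removes
both. The derivative of the cutoff is why the full `H¹` norm stands on the right. -/
theorem exists_lintegral_pow_six_le (m : ℕ) : ∃ K : ℝ≥0, ∀ (u : L2 m) (g : Fin 3 → L2 m),
    IsWeakGradient u g →
    ∫⁻ x, ‖u x‖ₑ ^ 6 ≤ K * ((∫⁻ x, ‖u x‖ₑ ^ 2) + ∑ j, ∫⁻ x, ‖g j x‖ₑ ^ 2) ^ 3 := by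
  obtain ⟨K, hK⟩ := exists_lintegral_pow_six_le_of_contDiff m
  obtain ⟨C, hC⟩ := exists_norm_fderiv_cutoff_le
  refine ⟨K * (2 * (1 + C ^ 2)) ^ 3, fun u g h => ?_⟩
  let w : ℕ → E3 → Cm m := fun k => mollify (shrinkingBump k) u
  have hw : ∀ k, ContDiff ℝ 1 (w k) := fun k => contDiff_mollify _ u
  let v : ℕ → E3 → Cm m := fun k x => cutoff k x • w k x
  have hv : ∀ k, ContDiff ℝ 1 (v k) := fun k => (contDiff_cutoff k).smul (hw k)
  have hvs : ∀ k, HasCompactSupport (v k) := fun k => (hasCompactSupport_cutoff k).smul_right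
  have hfv : ∀ k x, ‖fderiv ℝ (v k) x‖ₑ ^ 2
      ≤ 2 * (‖fderiv ℝ (w k) x‖ₑ ^ 2 + C ^ 2 * ‖w k x‖ₑ ^ 2) := by
    intro k x
    have h1 : fderiv ℝ (v k) x = cutoff k x • fderiv ℝ (w k) x
        + (fderiv ℝ (cutoff k) x).smulRight (w k x) :=
      fderiv_fun_smul ((contDiff_cutoff k).differentiable one_ne_zero x)
        ((hw k).differentiable one_ne_zero x)
    have h2 : ‖fderiv ℝ (v k) x‖ ≤ ‖fderiv ℝ (w k) x‖ + C * ‖w k x‖ := by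
      rw [h1]
      refine (norm_add_le _ _).trans (add_le_add ?_ ?_)
      · rw [norm_smul]
        exact mul_le_of_le_one_left (norm_nonneg _) (cutoff_mem k x)
      · rw [ContinuousLinearMap.norm_smulRight_apply]
        exact mul_le_mul_of_nonneg_right (hC k x) (norm_nonneg _)
    have h3 : ‖fderiv ℝ (v k) x‖ ^ 2 ≤ 2 * (‖fderiv ℝ (w k) x‖ ^ 2 + C ^ 2 * ‖w k x‖ ^ 2) := by
      have h4 := pow_le_pow_left₀ (norm_nonneg _) h2 2
      nlinarith [sq_nonneg (‖fderiv ℝ (w k) x‖ - C * ‖w k x‖)]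
    have h5 : (‖fderiv ℝ (v k) x‖₊) ^ 2
        ≤ 2 * (‖fderiv ℝ (w k) x‖₊ ^ 2 + C ^ 2 * ‖w k x‖₊ ^ 2) := by exact_mod_cast h3
    simp only [enorm_eq_nnnorm]
    exact_mod_cast h5
  set S := (∫⁻ x, ‖u x‖ₑ ^ 2) + ∑ j, ∫⁻ x, ‖g j x‖ₑ ^ 2 with hS
  have hfS : ∀ k, ∫⁻ x, ‖fderiv ℝ (v k) x‖ₑ ^ 2 ≤ 2 * (1 + C ^ 2) * S := by
    intro k
    have hcw := (hw k).continuous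
    have hcf := (hw k).continuous_fderiv one_ne_zero
    calc ∫⁻ x, ‖fderiv ℝ (v k) x‖ₑ ^ 2
        ≤ ∫⁻ x, 2 * (‖fderiv ℝ (w k) x‖ₑ ^ 2 + C ^ 2 * ‖w k x‖ₑ ^ 2) := lintegral_mono (hfv k)
      _ = 2 * ((∫⁻ x, ‖fderiv ℝ (w k) x‖ₑ ^ 2) + C ^ 2 * ∫⁻ x, ‖w k x‖ₑ ^ 2) := by
          rw [lintegral_const_mul _ (by fun_prop), lintegral_add_left (by fun_prop),
            lintegral_const_mul _ (by fun_prop)]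
      _ ≤ 2 * (S + C ^ 2 * S) := by
          gcongr
          · exact (lintegral_fderiv_mollify_le _ h).trans le_add_self
          · exact (lintegral_mollify_sq_le _ (Lp.stronglyMeasurable u)).trans le_self_add
      _ = _ := by ring
  calc ∫⁻ x, ‖u x‖ₑ ^ 6 = ∫⁻ x, liminf (fun k => ‖v k x‖ₑ ^ 6) atTop := by
        refine lintegral_congr_ae ?_
        filter_upwards [ae_tendsto_mollify u] with x hx
        have h1 := ((tendsto_cutoff x).smul hx).enorm
        rw [one_smul] at h1
        exact (((ENNReal.continuous_pow 6).tendsto _).comp h1).liminf_eq.symm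
    _ ≤ liminf (fun k => ∫⁻ x, ‖v k x‖ₑ ^ 6) atTop := by
        refine lintegral_liminf_le fun k => ?_
        have := (hv k).continuous
        exact Continuous.measurable (by fun_prop)
    _ ≤ liminf (fun _ : ℕ => (K : ℝ≥0∞) * (2 * (1 + C ^ 2) * S) ^ 3) atTop := by
        refine liminf_le_liminf (Eventually.of_forall fun k => ?_)
        refine (hK (v k) (hv k) (hvs k)).trans ?_
        gcongr
        exact hfS k
    _ = _ := by
        rw [liminf_const]; push_cast; ring

/-- Cauchy–Schwarz applied to `|u|⁴ = |u| · |u|³` interpolates between `L²` and `L⁶`. -/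
theorem exists_lintegral_pow_four_le (m : ℕ) : ∃ K : ℝ≥0, ∀ (u : L2 m) (g : Fin 3 → L2 m),
    IsWeakGradient u g →
    ∫⁻ x, ‖u x‖ₑ ^ 4 ≤ K * ((∫⁻ x, ‖u x‖ₑ ^ 2) + ∑ j, ∫⁻ x, ‖g j x‖ₑ ^ 2) ^ 2 := by
  obtain ⟨K, hK⟩ := exists_lintegral_pow_six_le m
  refine ⟨NNReal.sqrt K, fun u g h => ?_⟩
  have h6 := hK u g h
  set S := (∫⁻ x, ‖u x‖ₑ ^ 2) + ∑ j, ∫⁻ x, ‖g j x‖ₑ ^ 2 with hS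
  have hm : Measurable fun x => ‖u x‖ₑ := (Lp.stronglyMeasurable u).enorm
  have hol := ENNReal.lintegral_mul_le_Lp_mul_Lq volume Real.HolderConjugate.two_two
    hm.aemeasurable (hm.pow_const 3).aemeasurable
  simp only [Pi.mul_apply, ENNReal.rpow_ofNat, ← pow_succ', ← pow_mul] at hol
  norm_num at hol
  refine hol.trans ?_
  calc (∫⁻ x, ‖u x‖ₑ ^ 2) ^ (1 / 2 : ℝ) * (∫⁻ x, ‖u x‖ₑ ^ 6) ^ (1 / 2 : ℝ)
      ≤ S ^ (1 / 2 : ℝ) * (K * S ^ 3) ^ (1 / 2 : ℝ) := by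
        gcongr
        exact le_self_add
    _ = NNReal.sqrt K * S ^ 2 := by
        rw [ENNReal.mul_rpow_of_nonneg _ _ (by norm_num), mul_left_comm,
          ← ENNReal.rpow_natCast S 3, ← ENNReal.rpow_mul,
          ← ENNReal.rpow_add_of_nonneg _ _ (by norm_num) (by norm_num), NNReal.sqrt_eq_rpow,
          ← ENNReal.coe_rpow_of_nonneg _ (by norm_num), ← ENNReal.rpow_natCast S 2]
        norm_num

/-! ### Norms and densities of `H¹` functions -/

theorem lintegral_enorm_sq (u : L2 m) : ∫⁻ x, ‖u x‖ₑ ^ 2 = ENNReal.ofReal (‖u‖ ^ 2) := by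
  rw [Lp.norm_def, ← ENNReal.toReal_pow, ENNReal.ofReal_toReal
    (ENNReal.pow_ne_top (Lp.eLpNorm_ne_top u)), eLpNorm_eq_lintegral_rpow_enorm_toReal
    (by norm_num) (by norm_num), ← ENNReal.rpow_natCast, ← ENNReal.rpow_mul]
  norm_num

theorem integrable_norm_sq (u : L2 m) : Integrable fun x => ‖u x‖ ^ 2 :=
  (Lp.memLp u).integrable_norm_pow (by norm_num)

theorem integral_norm_sq (u : L2 m) : ∫ x, ‖u x‖ ^ 2 = ‖u‖ ^ 2 := by
  rw [integral_eq_lintegral_of_nonneg_ae (Eventually.of_forall fun x => by positivity)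
    (integrable_norm_sq u).aestronglyMeasurable]
  simp only [ENNReal.ofReal_pow (norm_nonneg _), ofReal_norm]
  rw [lintegral_enorm_sq, ENNReal.toReal_ofReal (by positivity)]

/-- `∑ⱼ ‖∂ⱼu‖₂²`. -/
def gradSq (u : H1 m) : ℝ := ∑ j, ‖partialDeriv u j‖ ^ 2

theorem gradSq_nonneg (u : H1 m) : 0 ≤ gradSq u := Finset.sum_nonneg fun _ _ => by positivity

theorem kinetic_eq (u : H1 m) : kinetic u = (1 / 2) * gradSq u := by
  rw [kinetic, integral_finsetSum _ fun j _ => integrable_norm_sq _]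
  simp only [integral_norm_sq, gradSq]

theorem norm_sq_eq (u : H1 m) : ‖u‖ ^ 2 = ‖toL2 u‖ ^ 2 + gradSq u := by
  have h : ‖(u : Pairs m)‖ ^ 2 = ‖(u : Pairs m).fst‖ ^ 2 + ‖(u : Pairs m).snd‖ ^ 2 :=
    WithLp.prod_norm_sq_eq_of_L2 _
  have h2 : ‖(u : Pairs m).snd‖ ^ 2 = ∑ j, ‖(u : Pairs m).snd j‖ ^ 2 :=
    PiLp.norm_sq_eq_of_L2 _ _
  rw [h2] at h
  exact h

theorem weakGradient (u : H1 m) : IsWeakGradient (toL2 u) (partialDeriv u) := u.2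

theorem lintegral_add_sum_eq (u : H1 m) :
    (∫⁻ x, ‖toL2 u x‖ₑ ^ 2) + ∑ j, ∫⁻ x, ‖partialDeriv u j x‖ₑ ^ 2
      = ENNReal.ofReal (‖u‖ ^ 2) := by
  simp only [lintegral_enorm_sq]
  rw [← ENNReal.ofReal_sum_of_nonneg (fun _ _ => by positivity),
    ← ENNReal.ofReal_add (by positivity) (Finset.sum_nonneg fun _ _ => by positivity),
    norm_sq_eq, gradSq]

theorem density_nonneg (u : H1 m) (x : E3) : 0 ≤ density u x := by
  unfold density; positivity

theorem integrable_density (u : H1 m) : Integrable (density u) := integrable_norm_sq _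

theorem integral_density (u : H1 m) : ∫ x, density u x = ‖toL2 u‖ ^ 2 := integral_norm_sq _

theorem measurable_density (u : H1 m) : Measurable (density u) :=
  ((Lp.stronglyMeasurable (toL2 u)).measurable.norm.pow_const 2)

theorem exists_eLpNorm_density_le (m : ℕ) : ∃ K : ℝ, 0 ≤ K ∧ ∀ u : H1 m,
    eLpNorm (density u) 2 volume ≤ ENNReal.ofReal (K * ‖u‖ ^ 2) := by
  obtain ⟨K, hK⟩ := exists_lintegral_pow_four_le m
  refine ⟨Real.sqrt K, Real.sqrt_nonneg _, fun u => ?_⟩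
  have h := hK _ _ (weakGradient u)
  rw [lintegral_add_sum_eq] at h
  rw [eLpNorm_eq_lintegral_rpow_enorm_toReal (by norm_num) (by norm_num)]
  have h2 : ∀ x, ‖density u x‖ₑ ^ (2 : ℝ≥0∞).toReal = ‖toL2 u x‖ₑ ^ 4 := by
    intro x
    simp only [density, enorm_pow, enorm_norm, ENNReal.toReal_ofNat, ENNReal.rpow_ofNat]
    ring
  simp only [h2]
  calc _ ≤ ((K : ℝ≥0∞) * ENNReal.ofReal (‖u‖ ^ 2) ^ 2) ^ (1 / (2 : ℝ≥0∞).toReal) := by gcongr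
    _ = _ := by
      rw [← ENNReal.ofReal_coe_nnreal, ← ENNReal.ofReal_pow (by positivity),
        ← ENNReal.ofReal_mul (by positivity), ENNReal.ofReal_rpow_of_nonneg (by positivity)
        (by positivity)]
      congr 1
      simp only [ENNReal.toReal_ofNat]
      rw [← Real.sqrt_eq_rpow, Real.sqrt_mul (by positivity), Real.sqrt_sq (by positivity)]

theorem memLp_density (u : H1 m) : MemLp (density u) 2 volume := by
  obtain ⟨K, _, hK⟩ := exists_eLpNorm_density_le m
  exact ⟨(measurable_density u).aestronglyMeasurable, (hK u).trans_lt ENNReal.ofReal_lt_top⟩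

/-! ### Rellich compactness on balls -/

/-- `A` is a bound for the bump kernel, so it is uniform in `u` and `x`. This is the dominating
constant in the Rellich argument. -/
theorem exists_enorm_mollify_sq_le (φ : ContDiffBump (0 : E3)) : ∃ A : ℝ≥0, ∀ (u : L2 m) (x : E3),
    ‖mollify φ u x‖ₑ ^ 2 ≤ A * ENNReal.ofReal (‖u‖ ^ 2) := by
  obtain ⟨C, hC⟩ := (φ.hasCompactSupport_normed (μ := (volume : Measure E3))).exists_bound_of_continuous
    φ.continuous_normed
  refine ⟨C.toNNReal, fun u x => ?_⟩
  have hu : StronglyMeasurable u := Lp.stronglyMeasurable u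
  have hm : Measurable fun t => ‖u (x - t)‖ₑ :=
    (hu.comp_measurable (measurable_const.sub measurable_id)).enorm
  rw [mollify_apply]
  calc ‖∫ t, u (x - t) ∂(bumpMeasure φ)‖ₑ ^ 2 ≤ (∫⁻ t, ‖u (x - t)‖ₑ ∂(bumpMeasure φ)) ^ 2 := by
        gcongr; exact enorm_integral_le_lintegral_enorm _
    _ ≤ ∫⁻ t, ‖u (x - t)‖ₑ ^ 2 ∂(bumpMeasure φ) :=
        sq_lintegral_le_lintegral_sq hm.aemeasurable
    _ = ∫⁻ t, (φ.normed volume t).toNNReal * ‖u (x - t)‖ₑ ^ 2 := by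
        rw [bumpMeasure, lintegral_withDensity_eq_lintegral_mul _
          (measurable_bump φ).coe_nnreal_ennreal (hm.pow_const 2)]
        rfl
    _ ≤ ∫⁻ t, C.toNNReal * ‖u (x - t)‖ₑ ^ 2 := by
        refine lintegral_mono fun t => ?_
        gcongr
        exact (le_abs_self _).trans (hC t)
    _ = _ := by
        rw [lintegral_const_mul _ (hm.pow_const 2),
          lintegral_sub_left_eq_self (fun t => ‖u t‖ₑ ^ 2) x, lintegral_enorm_sq]

/-- Each coordinate of the mollification at `x` is the inner product with the fixed `L²` function `y
↦ φ (x - y) eᵢ`. -/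
theorem tendsto_mollify_of_weak (φ : ContDiffBump (0 : E3)) {u : ℕ → L2 m}
    (hweak : ∀ v : L2 m, Tendsto (fun k => inner ℂ v (u k)) atTop (𝓝 0)) (x : E3) :
    Tendsto (fun k => mollify φ (u k) x) atTop (𝓝 0) := by
  have hcoord : ∀ i : Fin m, Tendsto (fun k => mollify φ (u k) x i) atTop (𝓝 0) := by
    intro i
    let f : E3 → Cm m := fun y => φ.normed volume (x - y) • EuclideanSpace.single i (1 : ℂ)
    have hfc : Continuous f := by
      have := φ.continuous_normed (μ := (volume : Measure E3))
      fun_prop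
    have hfs : HasCompactSupport f :=
      (φ.hasCompactSupport_normed.comp_homeomorph (Homeomorph.subLeft x)).smul_right
    have hf : MemLp f 2 volume := hfc.memLp_of_hasCompactSupport hfs
    refine (hweak hf.toLp).congr fun k => ?_
    rw [L2.inner_def]
    have hint : Integrable fun y => φ.normed volume (x - y) • u k y :=
      integrable_smul_L2 (φ.continuous_normed.comp (continuous_const.sub continuous_id))
        (φ.hasCompactSupport_normed.comp_homeomorph (Homeomorph.subLeft x)) (u k)
    have h1 : mollify φ (u k) x = ∫ y, φ.normed volume (x - y) • u k y := by
      rw [mollify, convolution_eq_swap]; rfl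
    have h2 := (EuclideanSpace.proj (𝕜 := ℂ) i : Cm m →L[ℂ] ℂ).integral_comp_comm hint
    rw [h1]
    change _ = (EuclideanSpace.proj (𝕜 := ℂ) i : Cm m →L[ℂ] ℂ) _
    rw [← h2]
    refine integral_congr_ae ?_
    filter_upwards [hf.coeFn_toLp] with y hy
    rw [hy]
    simp [f, inner_smul_left_eq_smul, EuclideanSpace.inner_single_left]
  have h := (PiLp.continuous_toLp 2 (fun _ : Fin m => ℂ)).tendsto 0 |>.comp
    (tendsto_pi_nhds.2 hcoord)
  exact h

/-- Local compactness (Rellich) for sequences with bounded weak gradients. -/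
theorem tendsto_setLIntegral_sq_of_weak {u : ℕ → L2 m} {g : ℕ → Fin 3 → L2 m} {M : ℝ≥0}
    (hg : ∀ k, IsWeakGradient (u k) (g k)) (hu : ∀ k, ∫⁻ x, ‖u k x‖ₑ ^ 2 ≤ M)
    (hgM : ∀ k, ∑ j, ∫⁻ x, ‖g k j x‖ₑ ^ 2 ≤ M)
    (hweak : ∀ v : L2 m, Tendsto (fun k => inner ℂ v (u k)) atTop (𝓝 0)) (R : ℝ) :
    Tendsto (fun k => ∫⁻ x in Metric.ball 0 R, ‖u k x‖ₑ ^ 2) atTop (𝓝 0) := by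
  have hlocal : ∀ φ : ContDiffBump (0 : E3),
      Tendsto (fun k => ∫⁻ x in Metric.ball 0 R, ‖mollify φ (u k) x‖ₑ ^ 2) atTop (𝓝 0) := by
    intro φ
    obtain ⟨A, hA⟩ := exists_enorm_mollify_sq_le (m := m) φ
    have h := tendsto_lintegral_of_dominated_convergence
      (μ := (volume : Measure E3).restrict (Metric.ball 0 R))
      (F := fun k x => ‖mollify φ (u k) x‖ₑ ^ 2) (f := fun _ => 0) (fun _ => (A : ℝ≥0∞) * M)
      (fun k => (contDiff_mollify φ (u k)).continuous.measurable.enorm.pow_const 2)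
      (fun k => Eventually.of_forall fun x => (hA (u k) x).trans (by
        rw [← lintegral_enorm_sq]
        change _ ≤ (A : ℝ≥0∞) * M
        gcongr; exact hu k))
      (by
        rw [lintegral_const]
        rw [Measure.restrict_apply_univ]
        exact ENNReal.mul_ne_top (by finiteness)
          (Metric.isBounded_ball.measure_lt_top (μ := (volume : Measure E3))).ne)
      (Eventually.of_forall fun x => by
        have h1 := (tendsto_mollify_of_weak φ hweak x).enorm
        have h2 := ((ENNReal.continuous_pow 2).tendsto _).comp h1
        simpa [Function.comp_def] using h2)
    simpa using h
  have hsplit : ∀ (φ : ContDiffBump (0 : E3)) k, ∫⁻ x in Metric.ball 0 R, ‖u k x‖ₑ ^ 2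
      ≤ 2 * (ENNReal.ofReal φ.rOut ^ 2 * M)
        + 2 * ∫⁻ x in Metric.ball 0 R, ‖mollify φ (u k) x‖ₑ ^ 2 := by
    intro φ k
    have hmu : Measurable (u k) := (Lp.stronglyMeasurable (u k)).measurable
    have hmm : Measurable (mollify φ (u k)) := (contDiff_mollify φ (u k)).continuous.measurable
    have hpt : ∀ x, ‖u k x‖ₑ ^ 2
        ≤ 2 * ‖mollify φ (u k) x - u k x‖ₑ ^ 2 + 2 * ‖mollify φ (u k) x‖ₑ ^ 2 := by
      intro x
      have h1 : ‖u k x‖ ≤ ‖mollify φ (u k) x - u k x‖ + ‖mollify φ (u k) x‖ := by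
        have := norm_sub_le (mollify φ (u k) x) (mollify φ (u k) x - u k x)
        rw [sub_sub_cancel] at this
        linarith
      have h2 : ‖u k x‖ ^ 2
          ≤ 2 * ‖mollify φ (u k) x - u k x‖ ^ 2 + 2 * ‖mollify φ (u k) x‖ ^ 2 := by
        have h4 := pow_le_pow_left₀ (norm_nonneg _) h1 2
        nlinarith [sq_nonneg (‖mollify φ (u k) x - u k x‖ - ‖mollify φ (u k) x‖)]
      have h5 : ‖u k x‖₊ ^ 2
          ≤ 2 * ‖mollify φ (u k) x - u k x‖₊ ^ 2 + 2 * ‖mollify φ (u k) x‖₊ ^ 2 := by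
        exact_mod_cast h2
      simp only [enorm_eq_nnnorm]
      exact_mod_cast h5
    calc ∫⁻ x in Metric.ball 0 R, ‖u k x‖ₑ ^ 2
        ≤ ∫⁻ x in Metric.ball 0 R, (2 * ‖mollify φ (u k) x - u k x‖ₑ ^ 2
            + 2 * ‖mollify φ (u k) x‖ₑ ^ 2) := lintegral_mono hpt
      _ = 2 * (∫⁻ x in Metric.ball 0 R, ‖mollify φ (u k) x - u k x‖ₑ ^ 2)
            + 2 * ∫⁻ x in Metric.ball 0 R, ‖mollify φ (u k) x‖ₑ ^ 2 := by
          rw [lintegral_add_left (by fun_prop),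
            lintegral_const_mul _ (by fun_prop),
            lintegral_const_mul _ (hmm.enorm.pow_const 2)]
      _ ≤ _ := by
          gcongr
          refine (setLIntegral_le_lintegral _ _).trans ?_
          refine (lintegral_mollify_sub_sq_le φ (hg k)).trans ?_
          gcongr
          exact hgM k
  -- The order of limits matters: `k → ∞` with the mollifier fixed, by dominated convergence, and
  -- only then the mollification radius to zero.
  have hlim : ∀ n : ℕ, limsup (fun k => ∫⁻ x in Metric.ball 0 R, ‖u k x‖ₑ ^ 2) atTop
      ≤ 2 * (ENNReal.ofReal (shrinkingBump n).rOut ^ 2 * M) := by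
    intro n
    have h1 := ((ENNReal.Tendsto.const_mul (a := 2) (hlocal (shrinkingBump n))
      (Or.inr (by norm_num))).const_add (2 * (ENNReal.ofReal (shrinkingBump n).rOut ^ 2 * M)))
    rw [mul_zero, add_zero] at h1
    rw [← h1.limsup_eq]
    exact limsup_le_limsup (Eventually.of_forall (hsplit (shrinkingBump n)))
  have hzero : Tendsto (fun n : ℕ => 2 * (ENNReal.ofReal (shrinkingBump n).rOut ^ 2 * M)) atTop
      (𝓝 0) := by
    have h1 := (ENNReal.tendsto_ofReal tendsto_shrinkingBump_rOut)
    have h2 := ((ENNReal.continuous_pow 2).tendsto _).comp h1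
    have h3 := ENNReal.Tendsto.mul_const (b := (M : ℝ≥0∞)) h2 (Or.inr (by simp))
    have h4 := ENNReal.Tendsto.const_mul (a := 2) h3 (Or.inr (by norm_num))
    simpa using h4
  exact tendsto_of_le_liminf_of_limsup_le (by simp)
    (ge_of_tendsto' hzero hlim)

/-- From `| |a|² - |b|² | ≤ |a - b| (|a| + |b|)` and Cauchy–Schwarz, the claim reduces to Rellich
for `u k - v`, which tends weakly to zero. -/
theorem tendsto_setIntegral_density_sub {u : ℕ → H1 m} {v : H1 m} {M : ℝ}
    (hM : ∀ k, ‖u k‖ ≤ M)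
    (hweak : ∀ w : L2 m, Tendsto (fun k => inner ℂ w (toL2 (u k))) atTop (𝓝 (inner ℂ w (toL2 v))))
    (R : ℝ) :
    Tendsto (fun k => ∫ x in Metric.ball 0 R, |density (u k) x - density v x|) atTop (𝓝 0) := by
  have hd : ∀ k, ‖u k - v‖ ^ 2 ≤ (M + ‖v‖) ^ 2 := fun k => by
    gcongr; exact (norm_sub_le _ _).trans (by gcongr; exact hM k)
  have hsum : ∀ k, (∫⁻ x, ‖toL2 (u k - v) x‖ₑ ^ 2)
      + ∑ j, ∫⁻ x, ‖partialDeriv (u k - v) j x‖ₑ ^ 2 ≤ ((M + ‖v‖) ^ 2).toNNReal := fun k => by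
    rw [lintegral_add_sum_eq]
    exact ENNReal.ofReal_le_ofReal (hd k)
  have hR := tendsto_setLIntegral_sq_of_weak (fun k => weakGradient (u k - v))
    (fun k => le_self_add.trans (hsum k)) (fun k => le_add_self.trans (hsum k))
    (fun w => by
      have h := (hweak w).sub_const (inner ℂ w (toL2 v))
      rw [sub_self] at h
      refine h.congr fun k => ?_
      rw [← inner_sub_right]; rfl) R
  have hmass : ∀ w : H1 m, ∫⁻ x, ‖toL2 w x‖ₑ ^ 2 ≤ ENNReal.ofReal (‖w‖ ^ 2) := fun w => by
    rw [← lintegral_add_sum_eq]; exact le_self_add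
  set B : ℝ≥0∞ := 2 * ENNReal.ofReal (M ^ 2) + 2 * ENNReal.ofReal (‖v‖ ^ 2) with hB
  have hbound : ∀ k, ∫⁻ x in Metric.ball 0 R, ‖density (u k) x - density v x‖ₑ
      ≤ (∫⁻ x in Metric.ball 0 R, ‖toL2 (u k - v) x‖ₑ ^ 2) ^ (1 / 2 : ℝ) * B ^ (1 / 2 : ℝ) := by
    intro k
    have hmu : Measurable (toL2 (u k)) := (Lp.stronglyMeasurable _).measurable
    have hmv : Measurable (toL2 v) := (Lp.stronglyMeasurable _).measurable
    have hmd : Measurable (toL2 (u k - v)) := (Lp.stronglyMeasurable _).measurable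
    have hol := ENNReal.lintegral_mul_le_Lp_mul_Lq
      ((volume : Measure E3).restrict (Metric.ball 0 R)) Real.HolderConjugate.two_two
      hmd.enorm.aemeasurable (hmu.enorm.add hmv.enorm).aemeasurable
    simp only [Pi.mul_apply, Pi.add_apply, ENNReal.rpow_ofNat] at hol
    have hpt : ∀ᵐ x, ‖density (u k) x - density v x‖ₑ
        ≤ ‖toL2 (u k - v) x‖ₑ * (‖toL2 (u k) x‖ₑ + ‖toL2 v x‖ₑ) := by
      have hsub : (toL2 (u k - v) : E3 → Cm m) =ᵐ[volume] toL2 (u k) - toL2 v :=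
        Lp.coeFn_sub (toL2 (u k)) (toL2 v)
      filter_upwards [hsub] with x hx
      rw [hx]
      simp only [density, Pi.sub_apply]
      have h1 : |‖toL2 (u k) x‖ ^ 2 - ‖toL2 v x‖ ^ 2|
          ≤ ‖toL2 (u k) x - toL2 v x‖ * (‖toL2 (u k) x‖ + ‖toL2 v x‖) := by
        rw [sq_sub_sq, abs_mul, abs_of_nonneg (by positivity : 0 ≤ ‖toL2 (u k) x‖ + ‖toL2 v x‖),
          mul_comm]
        gcongr
        exact abs_norm_sub_norm_le _ _
      have h2 := ENNReal.ofReal_le_ofReal h1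
      rwa [← Real.norm_eq_abs, ENNReal.ofReal_mul (norm_nonneg _),
        ENNReal.ofReal_add (norm_nonneg _) (norm_nonneg _), ofReal_norm, ofReal_norm,
        ofReal_norm, ofReal_norm] at h2
    refine (lintegral_mono_ae (ae_restrict_of_ae hpt)).trans (hol.trans ?_)
    gcongr
    refine (setLIntegral_le_lintegral _ _).trans ?_
    calc ∫⁻ x, (‖toL2 (u k) x‖ₑ + ‖toL2 v x‖ₑ) ^ 2
        ≤ ∫⁻ x, (2 * ‖toL2 (u k) x‖ₑ ^ 2 + 2 * ‖toL2 v x‖ₑ ^ 2) := by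
          refine lintegral_mono fun x => ?_
          simp only [enorm_eq_nnnorm]
          have : (‖toL2 (u k) x‖₊ + ‖toL2 v x‖₊) ^ 2
              ≤ 2 * ‖toL2 (u k) x‖₊ ^ 2 + 2 * ‖toL2 v x‖₊ ^ 2 := by
            rw [← mul_add]; exact add_sq_le
          exact_mod_cast this
      _ = 2 * (∫⁻ x, ‖toL2 (u k) x‖ₑ ^ 2) + 2 * ∫⁻ x, ‖toL2 v x‖ₑ ^ 2 := by
          rw [lintegral_add_left ((hmu.enorm.pow_const 2).const_mul 2),
            lintegral_const_mul _ (hmu.enorm.pow_const 2),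
            lintegral_const_mul _ (hmv.enorm.pow_const 2)]
      _ ≤ 2 * ENNReal.ofReal (M ^ 2) + 2 * ENNReal.ofReal (‖v‖ ^ 2) := by
          gcongr
          · refine (hmass _).trans (ENNReal.ofReal_le_ofReal ?_)
            gcongr; exact hM k
          · exact hmass v
  have hB' : B ^ (1 / 2 : ℝ) ≠ ⊤ := by
    rw [hB]; finiteness
  have hlim : Tendsto (fun k => (∫⁻ x in Metric.ball 0 R, ‖toL2 (u k - v) x‖ₑ ^ 2) ^ (1 / 2 : ℝ)
      * B ^ (1 / 2 : ℝ)) atTop (𝓝 0) := by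
    have h1 := hR.ennrpow_const (1 / 2 : ℝ)
    have h2 := ENNReal.Tendsto.mul_const (b := B ^ (1 / 2 : ℝ)) h1 (Or.inr hB')
    simpa using h2
  have h0 := tendsto_of_tendsto_of_tendsto_of_le_of_le tendsto_const_nhds hlim
    (fun _ => zero_le) hbound
  have h1 := (ENNReal.tendsto_toReal ENNReal.zero_ne_top).comp h0
  rw [ENNReal.toReal_zero] at h1
  refine h1.congr fun k => ?_
  simp only [Function.comp_apply, ← Real.norm_eq_abs]
  exact (integral_norm_eq_lintegral_enorm
    ((measurable_density (u k)).sub (measurable_density v)).aestronglyMeasurable).symm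

/-! ### The external potential -/

theorem integral_add_add {f g h : E3 → ℝ} (hf : Integrable f) (hg : Integrable g)
    (hh : Integrable h) :
    ∫ x, (f x + g x + h x) = (∫ x, f x) + (∫ x, g x) + ∫ x, h x := by
  rw [integral_add (f := fun x => f x + g x) (hf.add hg) hh, integral_add hf hg]

theorem integral_mul_le_eLpNorm_mul {f g : E3 → ℝ} (hf : MemLp f 2 volume) (hg : MemLp g 2 volume) :
    Integrable (fun x => f x * g x) ∧
      ∫ x, f x * g x ≤ (eLpNorm f 2 volume).toReal * (eLpNorm g 2 volume).toReal := by
  refine ⟨hf.integrable_mul hg, ?_⟩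
  have h : eLpNorm (f • g) 1 volume ≤ eLpNorm f 2 volume * eLpNorm g 2 volume :=
    eLpNorm_smul_le_mul_eLpNorm hg.1 hf.1
  rw [← ENNReal.toReal_mul]
  refine le_trans ?_ (ENNReal.toReal_mono (ENNReal.mul_ne_top hf.2.ne hg.2.ne) h)
  rw [eLpNorm_one_eq_lintegral_enorm, ← integral_norm_eq_lintegral_enorm (hf.1.smul hg.1)]
  exact integral_mono (hf.integrable_mul hg) (hf.integrable_mul hg).norm fun x => le_abs_self _

/-- A potential in `L²_loc` vanishing at infinity is, up to an arbitrarily small error, controlled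
by the mass on a ball. -/
theorem exists_integral_abs_mul_le {V : E3 → ℝ} (hVmeas : AEMeasurable V volume)
    (hVloc : ∀ K : Set E3, IsCompact K → MemLp V 2 (volume.restrict K))
    (hVlim : Tendsto V (cocompact E3) (𝓝 0)) {ε : ℝ} (hε : 0 < ε) :
    ∃ R M : ℝ, 0 ≤ M ∧ ∀ n : E3 → ℝ, Integrable n → MemLp n 2 volume → (∀ x, 0 ≤ n x) →
      Integrable (fun x => |V x| * n x) ∧
      ∫ x, |V x| * n x ≤ ε * (∫ x, n x) + ε * (eLpNorm n 2 volume).toReal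
        + M * ∫ x in Metric.ball 0 R, n x := by
  have h1 : ∀ᶠ x in cocompact E3, |V x| < ε := by
    have := (hVlim.abs).eventually (Iio_mem_nhds (show |(0 : ℝ)| < ε by simpa using hε))
    exact this
  rw [← Metric.cobounded_eq_cocompact] at h1
  obtain ⟨R, -, hR⟩ := (Metric.hasBasis_cobounded_compl_ball (0 : E3)).eventually_iff.1 h1
  have hWm : MemLp ((Metric.ball (0 : E3) R).indicator V) 2 volume := by
    rw [memLp_indicator_iff_restrict measurableSet_ball]
    exact (hVloc _ (isCompact_closedBall 0 R)).mono_measure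
      (Measure.restrict_mono Metric.ball_subset_closedBall le_rfl)
  set W := hWm.1.mk _ with hW
  have hWae : (Metric.ball (0 : E3) R).indicator V =ᵐ[volume] W := hWm.1.ae_eq_mk
  have hWs : StronglyMeasurable W := hWm.1.stronglyMeasurable_mk
  have hWL : MemLp W 2 volume := hWm.ae_eq hWae
  -- Truncation at height `M`: the part `T` of the potential above it has `L²` norm at most `ε`. The
  -- measurable representative `W` serves here because `V` is only a.e. measurable.
  obtain ⟨M, hM⟩ := hWL.eLpNorm_indicator_norm_ge_le hWs hε
  set T := {x | M ≤ ((‖W x‖₊ : ℝ≥0) : ℝ)}.indicator W with hT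
  have hTm : MemLp T 2 volume :=
    hWL.indicator (measurableSet_le measurable_const hWs.measurable.nnnorm.coe_nnreal_real)
  refine ⟨R, max M 0, le_max_right _ _, fun n hn hn2 hn0 => ?_⟩
  -- The three terms cover the region outside the ball, the large values of `V` inside it, and the
  -- remaining bounded values.
  have hpt : ∀ᵐ x, |V x| * n x
      ≤ ε * n x + ‖T x‖ * n x + max M 0 * (Metric.ball (0 : E3) R).indicator n x := by
    filter_upwards [hWae] with x hx
    by_cases hxR : x ∈ Metric.ball (0 : E3) R
    · rw [Set.indicator_of_mem hxR] at hx
      rw [Set.indicator_of_mem hxR]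
      by_cases hMx : M ≤ ((‖W x‖₊ : ℝ≥0) : ℝ)
      · have hTx : T x = W x := Set.indicator_of_mem (s := {x | M ≤ ((‖W x‖₊ : ℝ≥0) : ℝ)}) hMx W
        rw [hTx, hx, Real.norm_eq_abs]
        nlinarith [hn0 x, mul_nonneg hε.le (hn0 x), mul_nonneg (le_max_right M 0) (hn0 x)]
      · have h2 : |V x| ≤ max M 0 := by
          rw [hx, ← Real.norm_eq_abs]
          exact (not_le.1 hMx).le.trans (le_max_left _ _)
        nlinarith [mul_le_mul_of_nonneg_right h2 (hn0 x), mul_nonneg hε.le (hn0 x),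
          mul_nonneg (norm_nonneg (T x)) (hn0 x)]
    · rw [Set.indicator_of_notMem hxR]
      have h2 : |V x| ≤ ε := (hR hxR).le
      nlinarith [mul_le_mul_of_nonneg_right h2 (hn0 x), mul_nonneg (norm_nonneg (T x)) (hn0 x)]
  obtain ⟨hi, hle⟩ := integral_mul_le_eLpNorm_mul hTm.norm hn2
  have hib : Integrable ((Metric.ball (0 : E3) R).indicator n) :=
    hn.indicator measurableSet_ball
  have hsum : Integrable fun x => ε * n x + ‖T x‖ * n x
      + max M 0 * (Metric.ball (0 : E3) R).indicator n x :=
    ((hn.const_mul ε).add hi).add (hib.const_mul _)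
  have hint : Integrable fun x => |V x| * n x := by
    refine hsum.mono' ((hVmeas.abs.aestronglyMeasurable).mul hn.1) ?_
    filter_upwards [hpt] with x hx
    rwa [Real.norm_of_nonneg (mul_nonneg (abs_nonneg _) (hn0 x))]
  refine ⟨hint, (integral_mono_ae hint hsum hpt).trans ?_⟩
  rw [integral_add_add (hn.const_mul ε) hi (hib.const_mul _),
    integral_const_mul, integral_const_mul, integral_indicator measurableSet_ball]
  gcongr
  refine hle.trans ?_
  gcongr
  rw [eLpNorm_norm]
  exact ENNReal.toReal_le_of_le_ofReal hε.le hM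

/-! ### The Newton kernel and its potential -/

/-- The Newton kernel restricted to a ball around the origin. -/
def localKernel (δ : ℝ) : E3 → ℝ := (Metric.ball (0 : E3) δ).indicator fun y => ‖y‖⁻¹

/-- In polar coordinates the Jacobian `r²` cancels `|y|⁻²`, leaving the constant `1` on `(0,1)`. -/
theorem memLp_localKernel_one : MemLp (localKernel 1) 2 volume := by
  have hm : Measurable (localKernel 1) := measurable_norm.inv.indicator measurableSet_ball
  rw [memLp_two_iff_integrable_sq hm.aestronglyMeasurable]
  have h := (integrable_fun_norm_addHaar (volume : Measure E3)
    (f := (Set.Iio (1 : ℝ)).indicator fun r => (r⁻¹) ^ 2)).2 ?_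
  · refine h.congr (Eventually.of_forall fun x => ?_)
    simp only [localKernel, Set.indicator, Metric.mem_ball, dist_zero_right, Set.mem_Iio]
    split_ifs <;> simp
  · have h0 : IntegrableOn ((Set.Iio (1 : ℝ)).indicator fun _ => (1 : ℝ)) (Set.Ioi 0) := by
      rw [IntegrableOn, integrable_indicator_iff measurableSet_Iio, IntegrableOn,
        Measure.restrict_restrict measurableSet_Iio]
      refine integrable_const_iff.2 (Or.inr ⟨?_⟩)
      rw [Measure.restrict_apply_univ, Set.inter_comm, Set.Ioi_inter_Iio]
      simp
    refine h0.congr ?_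
    filter_upwards [ae_restrict_mem measurableSet_Ioi] with r hr
    have : r ≠ 0 := ne_of_gt hr
    simp only [Set.indicator, Set.mem_Iio]
    split_ifs
    · simp; field_simp
    · simp

theorem exists_eLpNorm_localKernel_le {ε : ℝ} (hε : 0 < ε) : ∃ δ : ℝ, 0 < δ ∧
    MemLp (localKernel δ) 2 volume ∧ eLpNorm (localKernel δ) 2 volume ≤ ENNReal.ofReal ε := by
  obtain ⟨η, hη, h⟩ := memLp_localKernel_one.eLpNorm_indicator_le (by norm_num) (by norm_num) hε
  have hlim : Tendsto (fun δ : ℝ => volume (Metric.ball (0 : E3) δ)) (𝓝[>] 0) (𝓝 0) := by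
    simp only [EuclideanSpace.volume_ball_fin_three]
    have h1 : Tendsto (fun δ : ℝ => ENNReal.ofReal δ ^ 3 * ENNReal.ofReal (Real.pi * 4 / 3))
        (𝓝 0) (𝓝 (ENNReal.ofReal 0 ^ 3 * ENNReal.ofReal (Real.pi * 4 / 3))) := by
      refine ENNReal.Tendsto.mul_const ?_ (Or.inr (by simp))
      exact ((ENNReal.continuous_pow 3).comp ENNReal.continuous_ofReal).tendsto 0
    simp only [ENNReal.ofReal_zero, ne_eq, OfNat.ofNat_ne_zero, not_false_eq_true, zero_pow,
      zero_mul] at h1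
    exact h1.mono_left nhdsWithin_le_nhds
  have hev := (hlim.eventually (Iic_mem_nhds (ENNReal.ofReal_pos.2 hη))).and
    ((Ioo_mem_nhdsGT (one_pos : (0 : ℝ) < 1)))
  obtain ⟨δ, hδ, hδ0, hδ1⟩ := hev.exists
  have he : localKernel δ = (Metric.ball (0 : E3) δ).indicator (localKernel 1) := by
    rw [localKernel, localKernel, Set.indicator_indicator, Set.inter_eq_left.2
      (Metric.ball_subset_ball hδ1.le)]
  refine ⟨δ, hδ0, ?_, ?_⟩
  · rw [he]; exact memLp_localKernel_one.indicator measurableSet_ball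
  · rw [he]; exact h _ measurableSet_ball hδ

/-- The Newton potential `∫ n(y) / |x - y| dy`. -/
def newtonPotential (n : E3 → ℝ) (x : E3) : ℝ := ∫ y, n y / ‖x - y‖

theorem newtonPotential_nonneg {n : E3 → ℝ} (hn0 : ∀ x, 0 ≤ n x) (x : E3) :
    0 ≤ newtonPotential n x :=
  integral_nonneg fun y => div_nonneg (hn0 y) (norm_nonneg _)

/-- The kernel is split at distances `δ` and `ρ`: Cauchy–Schwarz near the singularity, then the
bounds `1/δ` and `1/ρ`. Since `δ` depends on `ε` alone, `ρ` can be chosen freely afterwards. -/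
theorem exists_newtonPotential_le {ε : ℝ} (hε : 0 < ε) : ∃ δ : ℝ, 0 < δ ∧
    ∀ n : E3 → ℝ, Integrable n → MemLp n 2 volume → (∀ x, 0 ≤ n x) → ∀ x,
      Integrable (fun y => n y / ‖x - y‖) ∧ ∀ ρ : ℝ, 0 < ρ →
      newtonPotential n x ≤ ε * (eLpNorm n 2 volume).toReal
        + (1 / δ) * (∫ y in Metric.ball x ρ, n y) + (1 / ρ) * ∫ y, n y := by
  obtain ⟨δ, hδ, hmem, hle⟩ := exists_eLpNorm_localKernel_le hε
  refine ⟨δ, hδ, fun n hn hn2 hn0 x => ?_⟩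
  have hmp : MeasurePreserving (fun y : E3 => x - y) volume volume :=
    Measure.measurePreserving_sub_left volume x
  have hmem' : MemLp (fun y => localKernel δ (x - y)) 2 volume := hmem.comp_measurePreserving hmp
  have hle' : eLpNorm (fun y => localKernel δ (x - y)) 2 volume ≤ ENNReal.ofReal ε :=
    (eLpNorm_comp_measurePreserving hmem.1 hmp).trans_le hle
  obtain ⟨hi, hle2⟩ := integral_mul_le_eLpNorm_mul hmem' hn2
  have hpt : ∀ ρ : ℝ, 0 < ρ → ∀ y, n y / ‖x - y‖ ≤ localKernel δ (x - y) * n y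
      + (1 / δ) * (Metric.ball x ρ).indicator n y + (1 / ρ) * n y := by
    intro ρ hρ y
    have hn := hn0 y
    have hi0 : 0 ≤ (Metric.ball x ρ).indicator n y := Set.indicator_nonneg (fun y _ => hn0 y) y
    have hk0 : 0 ≤ localKernel δ (x - y) :=
      Set.indicator_nonneg (fun y _ => inv_nonneg.2 (norm_nonneg y)) _
    have a1 : 0 ≤ localKernel δ (x - y) * n y := mul_nonneg hk0 hn
    have a2 : 0 ≤ (1 / δ) * (Metric.ball x ρ).indicator n y := mul_nonneg (by positivity) hi0
    have a3 : 0 ≤ (1 / ρ) * n y := by positivity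
    by_cases h1 : ‖x - y‖ < δ
    · have : localKernel δ (x - y) = ‖x - y‖⁻¹ := Set.indicator_of_mem (by simpa using h1) _
      rw [this] at a1 ⊢
      rw [div_eq_inv_mul]
      linarith
    · by_cases h2 : ‖x - y‖ < ρ
      · have : (Metric.ball x ρ).indicator n y = n y :=
          Set.indicator_of_mem (by rwa [Metric.mem_ball, dist_eq_norm, norm_sub_rev]) _
        rw [this] at a2 ⊢
        have : n y / ‖x - y‖ ≤ (1 / δ) * n y := by
          rw [one_div_mul_eq_div]
          exact div_le_div_of_nonneg_left hn hδ (not_lt.1 h1)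
        linarith
      · have : n y / ‖x - y‖ ≤ (1 / ρ) * n y := by
          rw [one_div_mul_eq_div]
          exact div_le_div_of_nonneg_left hn hρ (not_lt.1 h2)
        linarith
  have hsum : ∀ ρ : ℝ, Integrable fun y => localKernel δ (x - y) * n y
      + (1 / δ) * (Metric.ball x ρ).indicator n y + (1 / ρ) * n y := fun ρ =>
    (hi.add ((hn.indicator measurableSet_ball).const_mul _)).add (hn.const_mul _)
  have hint : Integrable fun y => n y / ‖x - y‖ := by
    refine (hsum 1).mono' ?_ (Eventually.of_forall fun y => ?_)
    · exact (hn.1.aemeasurable.div (by fun_prop)).aestronglyMeasurable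
    · rw [Real.norm_of_nonneg (div_nonneg (hn0 y) (norm_nonneg _))]
      exact hpt 1 one_pos y
  refine ⟨hint, fun ρ hρ => (integral_mono hint (hsum ρ) (hpt ρ hρ)).trans ?_⟩
  rw [integral_add_add hi ((hn.indicator measurableSet_ball).const_mul _) (hn.const_mul _),
    integral_const_mul,
    integral_const_mul, integral_indicator measurableSet_ball]
  gcongr
  refine hle2.trans ?_
  gcongr
  exact ENNReal.toReal_le_of_le_ofReal hε.le hle'

/-! ### Rotation invariance and decay of mass in far balls -/

theorem norm_rotate (R : SO3) (x : E3) : ‖rotate R x‖ = ‖x‖ := by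
  have h : R.1 ∈ unitary (Matrix (Fin 3) (Fin 3) ℝ) :=
    (Matrix.mem_specialOrthogonalGroup_iff.1 R.2).1
  have h' : Matrix.toEuclideanCLM (n := Fin 3) (𝕜 := ℝ) R.1 ∈ unitary (E3 →L[ℝ] E3) :=
    Unitary.map_mem _ h
  exact (Unitary.linearIsometryEquiv ⟨_, h'⟩).norm_map x

theorem rotate_sub (R : SO3) (x y : E3) : rotate R (x - y) = rotate R x - rotate R y :=
  map_sub (Matrix.toEuclideanCLM (n := Fin 3) (𝕜 := ℝ) R.1) x y

theorem norm_valueAction (D : SO3 →* Matrix.unitaryGroup (Fin m) ℂ) (R : SO3) (z : Cm m) :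
    ‖valueAction D R z‖ = ‖z‖ := by
  have h' : valueAction D R ∈ unitary (Cm m →L[ℂ] Cm m) := Unitary.map_mem _ (D R).2
  exact (Unitary.linearIsometryEquiv ⟨_, h'⟩).norm_map z

theorem isometry_rotate (R : SO3) : Isometry (rotate R) :=
  Isometry.of_dist_eq fun x y => by rw [dist_eq_norm, dist_eq_norm, ← rotate_sub, norm_rotate]

/-- Unitarity of `D(R)` removes the representation on passing to `|u|²`; this is how the symmetry
enters the compactness argument. -/
theorem density_rotate {D : SO3 →* Matrix.unitaryGroup (Fin m) ℂ} (u : H1rho D) (R : SO3) :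
    (fun x => density (toH1 u) (rotate R x)) =ᵐ[volume] density (toH1 u) := by
  have h1 : rho D R⁻¹ (toL2 (toH1 u)) = toL2 (toH1 u) := u.2.2 R⁻¹
  have h2 := rho_ae_eq D R⁻¹ (toL2 (toH1 u))
  rw [h1, inv_inv] at h2
  filter_upwards [h2] with x hx
  simp only [density]
  rw [hx, norm_valueAction]

theorem setIntegral_ball_rotate {n : E3 → ℝ} (R : SO3)
    (hn : (fun x => n (rotate R x)) =ᵐ[volume] n) (x : E3) (ρ : ℝ) :
    ∫ y in Metric.ball (rotate R x) ρ, n y = ∫ y in Metric.ball x ρ, n y := by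
  have hemb : MeasurableEmbedding (rotate R) :=
    (isometry_rotate R).continuous.measurableEmbedding (isometry_rotate R).injective
  rw [← (measurePreserving_rotate R).setIntegral_preimage_emb hemb,
    (isometry_rotate R).preimage_ball]
  exact integral_congr_ae (ae_restrict_of_ae hn)

/-- The rotation about the third coordinate axis with cosine `c`. -/
def axisRotation (c : ℝ) (hc : c ^ 2 ≤ 1) : SO3 :=
  ⟨!![c, -Real.sqrt (1 - c ^ 2), 0; Real.sqrt (1 - c ^ 2), c, 0; 0, 0, 1], by
    have hs := Real.sq_sqrt (sub_nonneg.2 hc)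
    rw [Matrix.mem_specialOrthogonalGroup_iff, Matrix.mem_orthogonalGroup_iff]
    constructor
    · ext i j
      fin_cases i <;> fin_cases j <;> simp [Matrix.mul_apply, Fin.sum_univ_three] <;> nlinarith
    · rw [Matrix.det_fin_three]; simp; nlinarith⟩

/-- The rotation about the first coordinate axis with cosine `c`. -/
def axisRotation' (c : ℝ) (hc : c ^ 2 ≤ 1) : SO3 :=
  ⟨!![1, 0, 0; 0, c, -Real.sqrt (1 - c ^ 2); 0, Real.sqrt (1 - c ^ 2), c], by
    have hs := Real.sq_sqrt (sub_nonneg.2 hc)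
    rw [Matrix.mem_specialOrthogonalGroup_iff, Matrix.mem_orthogonalGroup_iff]
    constructor
    · ext i j
      fin_cases i <;> fin_cases j <;> simp [Matrix.mul_apply, Fin.sum_univ_three] <;> nlinarith
    · rw [Matrix.det_fin_three]; simp; nlinarith⟩

/-- The squared distance is `((c - c')² + (s - s')²)(x₀² + x₁²)` with `s, s'` the sines; the sine
term is dropped. -/
theorem dist_axisRotation (c c' : ℝ) (hc : c ^ 2 ≤ 1) (hc' : c' ^ 2 ≤ 1) (x : E3) :
    (c - c') ^ 2 * (x 0 ^ 2 + x 1 ^ 2)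
      ≤ ‖rotate (axisRotation c hc) x - rotate (axisRotation c' hc') x‖ ^ 2 := by
  rw [EuclideanSpace.norm_sq_eq, Fin.sum_univ_three]
  simp only [rotate, axisRotation, PiLp.sub_apply, Matrix.ofLp_toEuclideanCLM, Matrix.mulVec,
    dotProduct, Fin.sum_univ_three, Real.norm_eq_abs, sq_abs]
  simp
  nlinarith [mul_nonneg (sq_nonneg (√(1 - c ^ 2) - √(1 - c' ^ 2)))
    (add_nonneg (sq_nonneg (x 0)) (sq_nonneg (x 1)))]

theorem dist_axisRotation' (c c' : ℝ) (hc : c ^ 2 ≤ 1) (hc' : c' ^ 2 ≤ 1) (x : E3) :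
    (c - c') ^ 2 * (x 1 ^ 2 + x 2 ^ 2)
      ≤ ‖rotate (axisRotation' c hc) x - rotate (axisRotation' c' hc') x‖ ^ 2 := by
  rw [EuclideanSpace.norm_sq_eq, Fin.sum_univ_three]
  simp only [rotate, axisRotation', PiLp.sub_apply, Matrix.ofLp_toEuclideanCLM, Matrix.mulVec,
    dotProduct, Fin.sum_univ_three, Real.norm_eq_abs, sq_abs]
  simp
  nlinarith [mul_nonneg (sq_nonneg (√(1 - c ^ 2) - √(1 - c' ^ 2)))
    (add_nonneg (sq_nonneg (x 1)) (sq_nonneg (x 2)))]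

/-- At least one of the planes `(0,1)` and `(1,2)` carries half of `|x|²`. Rotations in that plane
with cosines `i/K` differ pairwise by at least `1/K` in cosine. -/
theorem exists_rotations_separated {K : ℕ} (hK : 0 < K) (x : E3) : ∃ R : Fin K → SO3,
    ∀ i j, i ≠ j → ‖x‖ ^ 2 ≤ 2 * K ^ 2 * ‖rotate (R i) x - rotate (R j) x‖ ^ 2 := by
  have hK0 : (0 : ℝ) < K := by exact_mod_cast hK
  have hc : ∀ i : Fin K, ((i : ℝ) / K) ^ 2 ≤ 1 := fun i => by
    have : (i : ℝ) / K ≤ 1 := by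
      rw [div_le_one hK0]; exact_mod_cast i.2.le
    exact pow_le_one₀ (by positivity) this
  have hd : ∀ i j : Fin K, i ≠ j → 1 ≤ K ^ 2 * ((i : ℝ) / K - (j : ℝ) / K) ^ 2 := by
    intro i j hij
    have h1 : (1 : ℤ) ≤ ((i : ℤ) - (j : ℤ)) ^ 2 := by
      have : ((i : ℤ) - (j : ℤ)) ≠ 0 := by
        intro h; apply hij; ext; omega
      have := sq_pos_of_ne_zero this
      omega
    have h2 : (1 : ℝ) ≤ ((i : ℝ) - (j : ℝ)) ^ 2 := by exact_mod_cast h1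
    have h3 : (K : ℝ) ^ 2 * ((i : ℝ) / K - (j : ℝ) / K) ^ 2 = ((i : ℝ) - (j : ℝ)) ^ 2 := by
      field_simp
    rw [h3]; exact h2
  have hx : ‖x‖ ^ 2 = x 0 ^ 2 + x 1 ^ 2 + x 2 ^ 2 := by
    rw [EuclideanSpace.norm_sq_eq, Fin.sum_univ_three]
    simp only [Real.norm_eq_abs, sq_abs]
  by_cases h : ‖x‖ ^ 2 ≤ 2 * (x 0 ^ 2 + x 1 ^ 2)
  · refine ⟨fun i => axisRotation ((i : ℝ) / K) (hc i), fun i j hij => ?_⟩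
    have h1 := dist_axisRotation _ _ (hc i) (hc j) x
    have h2 := mul_le_mul_of_nonneg_right (hd i j hij) (add_nonneg (sq_nonneg (x 0)) (sq_nonneg (x 1)))
    have h3 := mul_le_mul_of_nonneg_left h1 (sq_nonneg (K : ℝ))
    nlinarith
  · refine ⟨fun i => axisRotation' ((i : ℝ) / K) (hc i), fun i j hij => ?_⟩
    have h1 := dist_axisRotation' _ _ (hc i) (hc j) x
    have h2 := mul_le_mul_of_nonneg_right (hd i j hij) (add_nonneg (sq_nonneg (x 1)) (sq_nonneg (x 2)))
    have h3 := mul_le_mul_of_nonneg_left h1 (sq_nonneg (K : ℝ))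
    nlinarith [sq_nonneg (x 1)]

/-- The mass of a rotation invariant density in a far ball of fixed radius is small. -/
theorem setIntegral_ball_le_of_invariant {n : E3 → ℝ} (hn : Integrable n) (hn0 : ∀ x, 0 ≤ n x)
    (hinv : ∀ R : SO3, (fun x => n (rotate R x)) =ᵐ[volume] n) {K : ℕ} (hK : 0 < K) {ρ : ℝ}
    (hρ : 0 < ρ) {x : E3} (hx : 3 * K * ρ ≤ ‖x‖) :
    ∫ y in Metric.ball x ρ, n y ≤ (∫ y, n y) / K := by
  have hK0 : (0 : ℝ) < K := by exact_mod_cast hK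
  obtain ⟨R, hR⟩ := exists_rotations_separated hK x
  -- The factor `3` in `hx` gives squared distances of at least `9ρ²/2` between centres, which
  -- exceeds `(2ρ)²`.
  have hdisj : Pairwise (Function.onFun Disjoint fun i => Metric.ball (rotate (R i) x) ρ) := by
    intro i j hij
    refine Metric.ball_disjoint_ball ?_
    rw [dist_eq_norm]
    have h1 := hR i j hij
    have h2 : (3 * K * ρ) ^ 2 ≤ ‖x‖ ^ 2 := pow_le_pow_left₀ (by positivity) hx 2
    have h3 : (2 * (K : ℝ) ^ 2) * (ρ + ρ) ^ 2
        ≤ (2 * (K : ℝ) ^ 2) * ‖rotate (R i) x - rotate (R j) x‖ ^ 2 := by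
      nlinarith [mul_pos (pow_pos hK0 2) (pow_pos hρ 2)]
    exact le_of_sq_le_sq (le_of_mul_le_mul_left h3 (by positivity)) (norm_nonneg _)
  rw [le_div_iff₀ hK0]
  calc (∫ y in Metric.ball x ρ, n y) * K
      = ∑ i, ∫ y in Metric.ball (rotate (R i) x) ρ, n y := by
        simp only [setIntegral_ball_rotate _ (hinv _)]
        simp [mul_comm]
    _ = ∫ y in ⋃ i, Metric.ball (rotate (R i) x) ρ, n y :=
        (integral_iUnion_fintype (fun _ => measurableSet_ball) hdisj
          fun _ => hn.integrableOn).symm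
    _ ≤ ∫ y, n y := setIntegral_le_integral hn (Eventually.of_forall hn0)

/-! ### Coercivity of the energy -/

theorem mass_le_norm_sq (u : H1 m) : ‖toL2 u‖ ^ 2 ≤ ‖u‖ ^ 2 := by
  rw [norm_sq_eq]; linarith [gradSq_nonneg u]

/-- The constant in the embedding `H¹ ⊆ L⁴`. -/
def sobolevConst (m : ℕ) : ℝ := (exists_eLpNorm_density_le m).choose

theorem sobolevConst_nonneg (m : ℕ) : 0 ≤ sobolevConst m :=
  (exists_eLpNorm_density_le m).choose_spec.1

theorem eLpNorm_density_toReal_le (u : H1 m) :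
    (eLpNorm (density u) 2 volume).toReal ≤ sobolevConst m * ‖u‖ ^ 2 :=
  ENNReal.toReal_le_of_le_ofReal (mul_nonneg (sobolevConst_nonneg m) (by positivity))
    ((exists_eLpNorm_density_le m).choose_spec.2 u)

theorem exists_newtonPotential_density_le {ε : ℝ} (hε : 0 < ε) : ∃ C : ℝ, 0 ≤ C ∧
    ∀ (u : H1 m) x, newtonPotential (density u) x ≤ ε * ‖u‖ ^ 2 + C * ‖toL2 u‖ ^ 2 := by
  have hK := sobolevConst_nonneg m
  -- The `+ 1` keeps the denominator positive, as `sobolevConst` is only known to be nonnegative.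
  obtain ⟨δ, hδ, h⟩ := exists_newtonPotential_le (ε := ε / (sobolevConst m + 1)) (by positivity)
  refine ⟨1 / δ + 1, by positivity, fun u x => ?_⟩
  have h1 := (h _ (integrable_density u) (memLp_density u) (density_nonneg u) x).2 1 one_pos
  have h2 : ∫ y in Metric.ball x 1, density u y ≤ ‖toL2 u‖ ^ 2 := by
    rw [← integral_density]
    exact setIntegral_le_integral (integrable_density u) (Eventually.of_forall (density_nonneg u))
  rw [integral_density] at h1
  have h3 : ε / (sobolevConst m + 1) * (eLpNorm (density u) 2 volume).toReal ≤ ε * ‖u‖ ^ 2 := by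
    calc _ ≤ ε / (sobolevConst m + 1) * (sobolevConst m * ‖u‖ ^ 2) := by
          gcongr; exact eLpNorm_density_toReal_le u
      _ ≤ ε / (sobolevConst m + 1) * ((sobolevConst m + 1) * ‖u‖ ^ 2) := by
          gcongr; linarith
      _ = ε * ‖u‖ ^ 2 := by field_simp
  have h4 : 1 / δ * ∫ y in Metric.ball x 1, density u y ≤ 1 / δ * ‖toL2 u‖ ^ 2 := by gcongr
  linarith

theorem stronglyMeasurable_newtonPotential {n : E3 → ℝ} (hn : Measurable n) :
    StronglyMeasurable (newtonPotential n) := by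
  have h : StronglyMeasurable (Function.uncurry fun x y : E3 => n y / ‖x - y‖) :=
    ((hn.comp measurable_snd).div (measurable_fst.sub measurable_snd).norm).stronglyMeasurable
  exact h.integral_prod_right

theorem exists_newtonPotential_bound (u : H1 m) : ∃ C, ∀ x, newtonPotential (density u) x ≤ C := by
  obtain ⟨C, _, h⟩ := exists_newtonPotential_density_le (m := m) one_pos
  exact ⟨_, h u⟩

theorem integrable_mul_newtonPotential {f : E3 → ℝ} (hf : Integrable f) (v : H1 m) :
    Integrable fun x => f x * newtonPotential (density v) x := by
  obtain ⟨C, hC⟩ := exists_newtonPotential_bound v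
  refine hf.mul_bdd (c := C)
    (stronglyMeasurable_newtonPotential (measurable_density v)).aestronglyMeasurable
    (Eventually.of_forall fun x => ?_)
  rw [Real.norm_of_nonneg (newtonPotential_nonneg (density_nonneg v) x)]
  exact hC x

theorem selfGravity_eq (n : E3 → ℝ) :
    selfGravity n = (1 / (16 * Real.pi)) * ∫ x, n x * newtonPotential n x := by
  simp only [selfGravity, newtonPotential, ← integral_const_mul, mul_div_assoc]

/-- Fubini and the symmetry of the kernel; integrability on the product comes from the boundedness
of the Newton potential. -/
theorem integral_mul_newtonPotential_comm (u v : H1 m) :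
    ∫ x, density u x * newtonPotential (density v) x
      = ∫ x, density v x * newtonPotential (density u) x := by
  obtain ⟨δ, -, h⟩ := exists_newtonPotential_le one_pos
  have hint : Integrable (Function.uncurry fun x y : E3 => density u x * (density v y / ‖x - y‖))
      (volume.prod volume) := by
    have hm : Measurable (Function.uncurry fun x y : E3 =>
        density u x * (density v y / ‖x - y‖)) :=
      ((measurable_density u).comp measurable_fst).mul
        (((measurable_density v).comp measurable_snd).div
          (measurable_fst.sub measurable_snd).norm)
    rw [integrable_prod_iff hm.aestronglyMeasurable]
    refine ⟨Eventually.of_forall fun x => ?_, ?_⟩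
    · exact (h _ (integrable_density v) (memLp_density v) (density_nonneg v) x).1.const_mul
        (density u x)
    · refine (integrable_mul_newtonPotential (integrable_density u) v).congr
        (Eventually.of_forall fun x => ?_)
      simp only [newtonPotential, ← integral_const_mul]
      refine integral_congr_ae (Eventually.of_forall fun y => ?_)
      simp only [Function.uncurry_apply_pair]
      rw [Real.norm_of_nonneg (mul_nonneg (density_nonneg u x)
        (div_nonneg (density_nonneg v y) (norm_nonneg _)))]
  have hswap := integral_integral_swap hint
  simp only [newtonPotential, ← integral_const_mul]
  rw [hswap]
  refine integral_congr_ae (Eventually.of_forall fun x => ?_)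
  refine integral_congr_ae (Eventually.of_forall fun y => ?_)
  simp only [norm_sub_rev y x]
  ring

theorem external_eq {V : E3 → ℝ} (hV : ∀ x, V x ≤ 0) (n : E3 → ℝ) :
    external V n = (1 / 2) * ∫ x, |V x| * n x := by
  simp only [external, abs_of_nonpos (hV _)]

theorem external_nonneg {V : E3 → ℝ} (hV : ∀ x, V x ≤ 0) (u : H1 m) :
    0 ≤ external V (density u) := by
  rw [external_eq hV]
  exact mul_nonneg (by norm_num)
    (integral_nonneg fun x => mul_nonneg (abs_nonneg _) (density_nonneg u x))

/-- The energy controls the gradient on the constraint set. -/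
theorem exists_gradSq_le_energy {V : E3 → ℝ} (hVmeas : AEMeasurable V volume)
    (hVloc : ∀ K : Set E3, IsCompact K → MemLp V 2 (volume.restrict K))
    (hVlim : Tendsto V (cocompact E3) (𝓝 0)) (hVneg : ∀ x, V x ≤ 0) {N : ℝ} (hN : 0 < N) :
    ∃ C : ℝ, ∀ u : H1 m, ‖toL2 u‖ ^ 2 = N → (1 / 4) * gradSq u - C ≤ energy V u := by
  have hK := sobolevConst_nonneg m
  -- With this `ε` and the `η` below, the external and the gravitational term each absorb `gradSq /
  -- 8`, which leaves `1/4` of the kinetic coefficient `1/2`.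
  set ε : ℝ := 1 / (4 * (sobolevConst m + 1)) with hε
  have hε0 : 0 < ε := by positivity
  obtain ⟨R, M, hM, hV⟩ := exists_integral_abs_mul_le hVmeas hVloc hVlim hε0
  set a : ℝ := 1 / (16 * Real.pi) with ha
  have ha0 : 0 < a := by positivity
  set η : ℝ := 1 / (8 * a * N) with hη
  have hη0 : 0 < η := by positivity
  obtain ⟨C, hC, hpot⟩ := exists_newtonPotential_density_le (m := m) hη0
  refine ⟨(1 / 2) * (ε * N + N / 4 + M * N) + a * (N * (η * N + C * N)), fun u hu => ?_⟩
  have hnorm : ‖u‖ ^ 2 = N + gradSq u := by rw [norm_sq_eq, hu]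
  have hL := (hV _ (integrable_density u) (memLp_density u) (density_nonneg u)).2
  have hball : ∫ y in Metric.ball 0 R, density u y ≤ N := by
    rw [← hu, ← integral_density]
    exact setIntegral_le_integral (integrable_density u) (Eventually.of_forall (density_nonneg u))
  rw [integral_density, hu] at hL
  have h1 : ε * (eLpNorm (density u) 2 volume).toReal ≤ (1 / 4) * (N + gradSq u) := by
    calc ε * (eLpNorm (density u) 2 volume).toReal
        ≤ ε * ((sobolevConst m + 1) * ‖u‖ ^ 2) := by
          gcongr
          refine (eLpNorm_density_toReal_le u).trans ?_
          gcongr; linarith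
      _ = (1 / 4) * (N + gradSq u) := by rw [← hnorm, hε]; field_simp
  have h2 : M * ∫ y in Metric.ball 0 R, density u y ≤ M * N := by gcongr
  have hD : ∫ x, density u x * newtonPotential (density u) x
      ≤ N * (η * (N + gradSq u) + C * N) := by
    calc ∫ x, density u x * newtonPotential (density u) x
        ≤ ∫ x, density u x * (η * (N + gradSq u) + C * N) := by
          refine integral_mono (integrable_mul_newtonPotential (integrable_density u) u)
            ((integrable_density u).mul_const _) fun x => ?_
          have := hpot u x
          rw [hnorm, hu] at this
          exact mul_le_mul_of_nonneg_left this (density_nonneg u x)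
      _ = _ := by rw [integral_mul_const, integral_density, hu]
  have h3 : a * (N * (η * (N + gradSq u) + C * N))
      = a * (N * (η * N + C * N)) + (1 / 8) * gradSq u := by
    have : a * N * η = 1 / 8 := by rw [hη]; field_simp
    linear_combination gradSq u * this
  have h4 : selfGravity (density u) ≤ a * (N * (η * (N + gradSq u) + C * N)) := by
    rw [selfGravity_eq]
    exact mul_le_mul_of_nonneg_left hD ha0.le
  rw [energy, kinetic_eq, external_eq hVneg]
  linarith

/-! ### Weak continuity of the attractive terms -/

theorem integral_abs_density_sub_le (u v : H1 m) :
    ∫ x, |density u x - density v x| ≤ ‖u‖ ^ 2 + ‖v‖ ^ 2 := by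
  calc ∫ x, |density u x - density v x| ≤ ∫ x, (density u x + density v x) := by
        refine integral_mono ((integrable_density u).sub (integrable_density v)).abs
          ((integrable_density _).add (integrable_density _)) fun x => ?_
        have := density_nonneg u x
        have := density_nonneg v x
        exact abs_le.2 ⟨by linarith, by linarith⟩
    _ = ‖toL2 u‖ ^ 2 + ‖toL2 v‖ ^ 2 := by
        rw [integral_add (integrable_density _) (integrable_density _), integral_density,
          integral_density]
    _ ≤ _ := add_le_add (mass_le_norm_sq u) (mass_le_norm_sq v)

theorem eLpNorm_abs_density_sub_le (u v : H1 m) :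
    (eLpNorm (fun x => |density u x - density v x|) 2 volume).toReal
      ≤ sobolevConst m * (‖u‖ ^ 2 + ‖v‖ ^ 2) := by
  have hu := memLp_density u
  have hv := memLp_density v
  have h3 : eLpNorm (fun x => |density u x - density v x|) 2 volume
      ≤ eLpNorm (density u) 2 volume + eLpNorm (density v) 2 volume := by
    have h4 : eLpNorm (fun x => ‖(density u - density v) x‖) 2 volume
        = eLpNorm (density u - density v) 2 volume := eLpNorm_norm _
    exact h4.trans_le (eLpNorm_sub_le hu.1 hv.1 one_le_two)
  have h5 := ENNReal.toReal_mono (ENNReal.add_ne_top.2 ⟨hu.2.ne, hv.2.ne⟩) h3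
  rw [ENNReal.toReal_add hu.2.ne hv.2.ne] at h5
  linarith [eLpNorm_density_toReal_le u, eLpNorm_density_toReal_le v]

theorem tendsto_external {V : E3 → ℝ} (hVmeas : AEMeasurable V volume)
    (hVloc : ∀ K : Set E3, IsCompact K → MemLp V 2 (volume.restrict K))
    (hVlim : Tendsto V (cocompact E3) (𝓝 0)) (hVneg : ∀ x, V x ≤ 0)
    {u : ℕ → H1 m} {v : H1 m} {M : ℝ} (hM : ∀ k, ‖u k‖ ≤ M)
    (hweak : ∀ w : L2 m, Tendsto (fun k => inner ℂ w (toL2 (u k))) atTop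
      (𝓝 (inner ℂ w (toL2 v)))) :
    Tendsto (fun k => external V (density (u k))) atTop (𝓝 (external V (density v))) := by
  have hK := sobolevConst_nonneg m
  have hM0 : 0 ≤ M := (norm_nonneg _).trans (hM 0)
  simp only [external_eq hVneg]
  refine Tendsto.const_mul _ ?_
  rw [Metric.tendsto_atTop']
  intro η hη
  set B : ℝ := (M ^ 2 + ‖v‖ ^ 2) * (1 + sobolevConst m) + 1 with hB
  have hB0 : 0 < B := by positivity
  obtain ⟨R, A, hA, hV⟩ := exists_integral_abs_mul_le hVmeas hVloc hVlim
    (ε := η / (2 * B)) (by positivity)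
  have hloc := (tendsto_setIntegral_density_sub hM hweak R).const_mul A
  rw [mul_zero] at hloc
  obtain ⟨k₀, hk₀⟩ := eventually_atTop.1 (hloc.eventually (Iio_mem_nhds (half_pos hη)))
  refine ⟨k₀, fun k hk => ?_⟩
  have hI : ∀ w : H1 m, Integrable fun x => |V x| * density w x := fun w =>
    (hV _ (integrable_density w) (memLp_density w) (density_nonneg w)).1
  have hdi : Integrable fun x => |density (u k) x - density v x| :=
    ((integrable_density (u k)).sub (integrable_density v)).abs
  have hdm : MemLp (fun x => |density (u k) x - density v x|) 2 volume := by
    have := ((memLp_density (u k)).sub (memLp_density v)).norm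
    exact this
  -- The potential bound is applied to `|n_k - n|`: its two global terms stay bounded and carry the
  -- small factor, and its ball term tends to zero by Rellich.
  obtain ⟨hi, hle⟩ := hV _ hdi hdm fun x => abs_nonneg _
  have hsq : ‖u k‖ ^ 2 ≤ M ^ 2 := pow_le_pow_left₀ (norm_nonneg _) (hM k) 2
  have h1 : ∫ x, |density (u k) x - density v x| ≤ M ^ 2 + ‖v‖ ^ 2 :=
    (integral_abs_density_sub_le (u k) v).trans (by gcongr)
  have h2 : (eLpNorm (fun x => |density (u k) x - density v x|) 2 volume).toReal
      ≤ sobolevConst m * (M ^ 2 + ‖v‖ ^ 2) :=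
    (eLpNorm_abs_density_sub_le (u k) v).trans (by gcongr)
  have h3 : A * ∫ x in Metric.ball 0 R, |density (u k) x - density v x| < η / 2 :=
    hk₀ k (le_of_lt hk)
  rw [Real.dist_eq, ← integral_sub (hI _) (hI _)]
  calc |∫ x, (|V x| * density (u k) x - |V x| * density v x)|
      ≤ ∫ x, |V x| * |density (u k) x - density v x| := by
        refine (abs_integral_le_integral_abs).trans_eq ?_
        refine integral_congr_ae (Eventually.of_forall fun x => ?_)
        simp only [← mul_sub, abs_mul, abs_abs]
    _ ≤ _ := hle
    _ ≤ η / (2 * B) * (M ^ 2 + ‖v‖ ^ 2) + η / (2 * B) * (sobolevConst m * (M ^ 2 + ‖v‖ ^ 2))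
        + A * ∫ x in Metric.ball 0 R, |density (u k) x - density v x| := by gcongr
    _ < η / (2 * B) * B + η / 2 := by
        rw [← mul_add]
        refine add_lt_add_of_le_of_lt ?_ h3
        gcongr
        rw [hB]; linarith
    _ = η := by field_simp; ring

/-- Each of the three zones of the kernel contributes at most `η / 3`: the near zone by smallness of
its `L²` norm, the far zone by a large `ρ`, and the middle zone by dividing the mass among `k`
disjoint rotated balls. -/
theorem exists_newtonPotential_le_of_far (D : SO3 →* Matrix.unitaryGroup (Fin m) ℂ) (M : ℝ)
    {η : ℝ} (hη : 0 < η) :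
    ∃ R : ℝ, ∀ (u : H1rho D) (x : E3), ‖toH1 u‖ ≤ M → R ≤ ‖x‖ →
      newtonPotential (density (toH1 u)) x ≤ η := by
  have hK := sobolevConst_nonneg m
  obtain ⟨δ, hδ, h⟩ := exists_newtonPotential_le
    (ε := η / (3 * (sobolevConst m * M ^ 2 + 1))) (by positivity)
  set ρ : ℝ := 3 * (M ^ 2 + 1) / η with hρ
  have hρ0 : 0 < ρ := by positivity
  obtain ⟨k, hk⟩ := exists_nat_gt (3 * M ^ 2 / (δ * η))
  have hk0 : (0 : ℝ) < k := lt_of_le_of_lt (by positivity) hk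
  have hkpos : 0 < k := by exact_mod_cast hk0
  refine ⟨3 * k * ρ, fun u x hu hx => ?_⟩
  have hsq : ‖toH1 u‖ ^ 2 ≤ M ^ 2 := pow_le_pow_left₀ (norm_nonneg _) hu 2
  have hmass : ∫ y, density (toH1 u) y ≤ M ^ 2 := by
    rw [integral_density]; exact (mass_le_norm_sq _).trans hsq
  have h1 := (h _ (integrable_density (toH1 u)) (memLp_density _) (density_nonneg _) x).2 ρ hρ0
  have h2 := setIntegral_ball_le_of_invariant (integrable_density (toH1 u)) (density_nonneg _)
    (density_rotate u) hkpos hρ0 hx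
  have e1 : η / (3 * (sobolevConst m * M ^ 2 + 1)) * (eLpNorm (density (toH1 u)) 2 volume).toReal
      ≤ η / 3 := by
    calc _ ≤ η / (3 * (sobolevConst m * M ^ 2 + 1)) * (sobolevConst m * M ^ 2 + 1) := by
          gcongr
          refine (eLpNorm_density_toReal_le _).trans ?_
          have := mul_le_mul_of_nonneg_left hsq hK
          linarith
      _ = η / 3 := by field_simp
  have e2 : 1 / δ * ∫ y in Metric.ball x ρ, density (toH1 u) y ≤ η / 3 := by
    calc _ ≤ 1 / δ * (M ^ 2 / k) := by
          gcongr
          exact h2.trans (by gcongr)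
      _ ≤ η / 3 := by
          rw [div_lt_iff₀ (by positivity)] at hk
          rw [one_div_mul_eq_div, div_div, div_le_iff₀ (by positivity)]
          nlinarith
  have e3 : 1 / ρ * ∫ y, density (toH1 u) y ≤ η / 3 := by
    calc _ ≤ 1 / ρ * (M ^ 2 + 1) := by gcongr; linarith
      _ = η / 3 := by rw [hρ]; field_simp
  linarith

theorem tendsto_selfGravity {D : SO3 →* Matrix.unitaryGroup (Fin m) ℂ}
    {u : ℕ → H1rho D} {v : H1rho D} {M : ℝ} (hM : ∀ k, ‖toH1 (u k)‖ ≤ M)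
    (hweak : ∀ w : L2 m, Tendsto (fun k => inner ℂ w (toL2 (toH1 (u k)))) atTop
      (𝓝 (inner ℂ w (toL2 (toH1 v))))) :
    Tendsto (fun k => selfGravity (density (toH1 (u k)))) atTop
      (𝓝 (selfGravity (density (toH1 v)))) := by
  have hM0 : 0 ≤ M := (norm_nonneg _).trans (hM 0)
  set M' : ℝ := max M ‖toH1 v‖ with hM'
  have hM'0 : 0 ≤ M' := hM0.trans (le_max_left _ _)
  simp only [selfGravity_eq]
  refine Tendsto.const_mul _ ?_
  rw [Metric.tendsto_atTop']
  intro η hη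
  obtain ⟨R, hR⟩ := exists_newtonPotential_le_of_far D M' (η := η / (8 * (M' ^ 2 + 1)))
    (by positivity)
  obtain ⟨C, hC, hpot⟩ := exists_newtonPotential_density_le (m := m) one_pos
  have hbd : ∀ w : H1 m, ‖w‖ ≤ M' → ∀ x, newtonPotential (density w) x ≤ (1 + C) * M' ^ 2 := by
    intro w hw x
    have h1 := hpot w x
    have h2 : ‖w‖ ^ 2 ≤ M' ^ 2 := pow_le_pow_left₀ (norm_nonneg _) hw 2
    have h3 := mul_le_mul_of_nonneg_left ((mass_le_norm_sq w).trans h2) hC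
    linarith
  have hloc := (tendsto_setIntegral_density_sub hM hweak R).const_mul (2 * ((1 + C) * M' ^ 2))
  rw [mul_zero] at hloc
  obtain ⟨k₀, hk₀⟩ := eventually_atTop.1 (hloc.eventually (Iio_mem_nhds (half_pos hη)))
  refine ⟨k₀, fun k hk => ?_⟩
  have hloc' := hk₀ k (le_of_lt hk)
  have huM : ‖toH1 (u k)‖ ≤ M' := (hM k).trans (le_max_left _ _)
  have hvM : ‖toH1 v‖ ≤ M' := le_max_right _ _
  set a := density (toH1 (u k)) with ha
  set b := density (toH1 v) with hb
  have hai : Integrable a := integrable_density _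
  have hbi : Integrable b := integrable_density _
  have hdi : Integrable fun x => |a x - b x| := (hai.sub hbi).abs
  have hmass : ∀ w : H1 m, ‖w‖ ≤ M' → ∫ x, density w x ≤ M' ^ 2 := fun w hw => by
    rw [integral_density]
    exact (mass_le_norm_sq w).trans (pow_le_pow_left₀ (norm_nonneg _) hw 2)
  -- The difference of the quadratic forms factors because the bilinear form is symmetric. Then `a -
  -- b` is small in `L¹` inside the ball of radius `R`, and both potentials are small outside it.
  have hid : (∫ x, a x * newtonPotential a x) - ∫ x, b x * newtonPotential b x
      = ∫ x, (a x - b x) * (newtonPotential a x + newtonPotential b x) := by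
    have e : ∀ x, (a x - b x) * (newtonPotential a x + newtonPotential b x)
        = (a x * newtonPotential a x - b x * newtonPotential b x)
          + (a x * newtonPotential b x - b x * newtonPotential a x) := fun x => by ring
    simp only [e]
    have i1 : Integrable fun x => a x * newtonPotential a x := integrable_mul_newtonPotential hai _
    have i2 : Integrable fun x => b x * newtonPotential b x := integrable_mul_newtonPotential hbi _
    have i3 : Integrable fun x => a x * newtonPotential b x := integrable_mul_newtonPotential hai _
    have i4 : Integrable fun x => b x * newtonPotential a x := integrable_mul_newtonPotential hbi _
    rw [integral_add (f := fun x => a x * newtonPotential a x - b x * newtonPotential b x)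
        (g := fun x => a x * newtonPotential b x - b x * newtonPotential a x)
        (i1.sub i2) (i3.sub i4), integral_sub i1 i2, integral_sub i3 i4,
      integral_mul_newtonPotential_comm (toH1 (u k)) (toH1 v), sub_self, add_zero]
  have hpt : ∀ x, |(a x - b x) * (newtonPotential a x + newtonPotential b x)|
      ≤ 2 * ((1 + C) * M' ^ 2) * (Metric.ball 0 R).indicator (fun x => |a x - b x|) x
        + 2 * (η / (8 * (M' ^ 2 + 1))) * (a x + b x) := by
    intro x
    have ha0 : 0 ≤ a x := density_nonneg _ x
    have hb0 : 0 ≤ b x := density_nonneg _ x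
    have hp0 : 0 ≤ newtonPotential a x := newtonPotential_nonneg (density_nonneg _) x
    have hq0 : 0 ≤ newtonPotential b x := newtonPotential_nonneg (density_nonneg _) x
    rw [abs_mul, abs_of_nonneg (add_nonneg hp0 hq0)]
    have hη' : 0 ≤ 2 * (η / (8 * (M' ^ 2 + 1))) * (a x + b x) :=
      mul_nonneg (by positivity) (add_nonneg ha0 hb0)
    by_cases hx : x ∈ Metric.ball (0 : E3) R
    · rw [Set.indicator_of_mem hx]
      have h1 := hbd _ huM x
      have h2 := hbd _ hvM x
      have h3 : newtonPotential a x + newtonPotential b x ≤ 2 * ((1 + C) * M' ^ 2) := by linarith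
      have h4 := mul_le_mul_of_nonneg_left h3 (abs_nonneg (a x - b x))
      linarith
    · rw [Set.indicator_of_notMem hx, mul_zero, zero_add]
      have hx' : R ≤ ‖x‖ := by simpa using hx
      have h1 := hR (u k) x huM hx'
      have h2 := hR v x hvM hx'
      have h3 : newtonPotential a x + newtonPotential b x ≤ 2 * (η / (8 * (M' ^ 2 + 1))) := by
        linarith
      have h4 : |a x - b x| ≤ a x + b x := abs_le.2 ⟨by linarith, by linarith⟩
      rw [mul_comm]
      exact mul_le_mul h3 h4 (abs_nonneg _) (by positivity)
  rw [Real.dist_eq, hid]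
  calc |∫ x, (a x - b x) * (newtonPotential a x + newtonPotential b x)|
      ≤ ∫ x, (2 * ((1 + C) * M' ^ 2) * (Metric.ball 0 R).indicator (fun x => |a x - b x|) x
        + 2 * (η / (8 * (M' ^ 2 + 1))) * (a x + b x)) := by
        refine (abs_integral_le_integral_abs).trans ?_
        refine integral_mono_of_nonneg (Eventually.of_forall fun x => abs_nonneg _) ?_
          (Eventually.of_forall hpt)
        have := ((hdi.indicator (measurableSet_ball (x := (0 : E3)) (ε := R))).const_mul (2 * ((1 + C) * M' ^ 2))).add
          ((hai.add hbi).const_mul (2 * (η / (8 * (M' ^ 2 + 1)))))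
        exact this
    _ = 2 * ((1 + C) * M' ^ 2) * (∫ x in Metric.ball 0 R, |a x - b x|)
        + 2 * (η / (8 * (M' ^ 2 + 1))) * ((∫ x, a x) + ∫ x, b x) := by
        rw [integral_add ((hdi.indicator measurableSet_ball).const_mul _)
          (g := fun x => 2 * (η / (8 * (M' ^ 2 + 1))) * (a x + b x))
          ((hai.add hbi).const_mul _), integral_const_mul, integral_const_mul,
          integral_indicator measurableSet_ball, integral_add hai hbi]
    _ < η / 2 + 2 * (η / (8 * (M' ^ 2 + 1))) * (2 * (M' ^ 2 + 1)) := by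
        refine add_lt_add_of_lt_of_le hloc' ?_
        gcongr
        have h1 := hmass _ huM
        have h2 := hmass _ hvM
        linarith
    _ = η := by field_simp; ring

/-! ### Scaling laws and negativity of the infimum -/

theorem quasiMeasurePreserving_const_smul {l : ℝ} (hl : l ≠ 0) :
    Measure.QuasiMeasurePreserving (fun x : E3 => l • x) volume volume := by
  refine ⟨measurable_const_smul l, ?_⟩
  rw [Measure.map_addHaar_smul _ hl]
  exact Measure.smul_absolutelyContinuous

theorem memLp_comp_smul {l : ℝ} (hl : l ≠ 0) (u : L2 m) :
    MemLp (fun x => u (l • x)) 2 volume := by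
  have h : MemLp u 2 (Measure.map (fun x : E3 => l • x) volume) := by
    rw [Measure.map_addHaar_smul _ hl]
    exact (Lp.memLp u).smul_measure ENNReal.ofReal_ne_top
  exact h.comp_of_map (measurable_const_smul l).aemeasurable

/-- The dilated function `x ↦ u(l x)`. -/
def dilate (l : ℝ) (hl : l ≠ 0) (u : L2 m) : L2 m := (memLp_comp_smul hl u).toLp

theorem coeFn_dilate {l : ℝ} (hl : l ≠ 0) (u : L2 m) :
    (dilate l hl u : E3 → Cm m) =ᵐ[volume] fun x => u (l • x) :=
  (memLp_comp_smul hl u).coeFn_toLp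

theorem integral_comp_dilation {E : Type*} [NormedAddCommGroup E] [NormedSpace ℝ E] {l : ℝ}
    (hl : 0 < l) (f : E3 → E) : ∫ x, f (l • x) = (l ^ 3)⁻¹ • ∫ x, f x := by
  rw [Measure.integral_comp_smul_of_nonneg volume f l (hR := hl.le)]
  simp

theorem norm_sq_dilate {l : ℝ} (hl : 0 < l) (u : L2 m) :
    ‖dilate l hl.ne' u‖ ^ 2 = (l ^ 3)⁻¹ * ‖u‖ ^ 2 := by
  rw [← integral_norm_sq, ← integral_norm_sq, ← smul_eq_mul,
    ← integral_comp_dilation hl (fun x => ‖u x‖ ^ 2)]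
  refine integral_congr_ae ?_
  filter_upwards [coeFn_dilate hl.ne' u] with x hx
  rw [hx]

/-- The definition for `u` is tested with `φ (l⁻¹ ·)`, followed by a change of variables. -/
theorem isWeakGradient_dilate {l : ℝ} (hl : 0 < l) {u : L2 m} {g : Fin 3 → L2 m}
    (h : IsWeakGradient u g) :
    IsWeakGradient (dilate l hl.ne' u) (fun j => (l : ℂ) • dilate l hl.ne' (g j)) := by
  intro φ hφ hs j
  have hψ : ContDiff ℝ ∞ fun y => φ (l⁻¹ • y) := hφ.comp (contDiff_const_smul _)
  have hψs : HasCompactSupport fun y => φ (l⁻¹ • y) := hs.comp_smul (inv_ne_zero hl.ne')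
  have hfd : ∀ y, fderiv ℝ (fun y => φ (l⁻¹ • y)) y (EuclideanSpace.single j 1)
      = l⁻¹ * fderiv ℝ φ (l⁻¹ • y) (EuclideanSpace.single j 1) := by
    intro y
    rw [fderiv_comp_smul (f := φ)]
    rfl
  have hw := h _ hψ hψs j
  simp only [hfd] at hw
  have e1 := integral_comp_dilation hl
    (fun y => (l⁻¹ * fderiv ℝ φ (l⁻¹ • y) (EuclideanSpace.single j 1)) • u y)
  have e2 := integral_comp_dilation hl (fun y => φ (l⁻¹ • y) • g j y)
  simp only [smul_smul, inv_mul_cancel₀ hl.ne', one_smul] at e1 e2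
  have e3 : ∫ x, (fderiv ℝ φ x (EuclideanSpace.single j 1)) • (dilate l hl.ne' u x)
      = l • ∫ x, (l⁻¹ * fderiv ℝ φ x (EuclideanSpace.single j 1)) • u (l • x) := by
    rw [← integral_smul]
    refine integral_congr_ae ?_
    filter_upwards [coeFn_dilate hl.ne' u] with x hx
    rw [hx, smul_smul, mul_inv_cancel_left₀ hl.ne']
  have e4 : ∫ x, φ x • (((l : ℂ) • dilate l hl.ne' (g j) : L2 m) x)
      = l • ∫ x, φ x • g j (l • x) := by
    rw [← integral_smul]
    refine integral_congr_ae ?_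
    filter_upwards [Lp.coeFn_smul (l : ℂ) (dilate l hl.ne' (g j)), coeFn_dilate hl.ne' (g j)]
      with x hx hx2
    rw [hx, Pi.smul_apply, hx2, smul_comm]
    rfl
  rw [e3, e4, e1, e2, hw, smul_neg, smul_neg]

theorem rotate_smul (R : SO3) (l : ℝ) (x : E3) : rotate R (l • x) = l • rotate R x :=
  map_smul (Matrix.toEuclideanCLM (n := Fin 3) (𝕜 := ℝ) R.1) l x

theorem rho_dilate (D : SO3 →* Matrix.unitaryGroup (Fin m) ℂ) (R : SO3) {l : ℝ} (hl : l ≠ 0)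
    (u : L2 m) : rho D R (dilate l hl u) = dilate l hl (rho D R u) := by
  refine Lp.ext ?_
  filter_upwards [rho_ae_eq D R (dilate l hl u), coeFn_dilate hl (rho D R u),
    (quasiMeasurePreserving_const_smul hl).ae (rho_ae_eq D R u),
    (measurePreserving_rotate R⁻¹).quasiMeasurePreserving.ae (coeFn_dilate hl u)]
    with x h1 h2 h3 h4
  rw [h1, h2, h3, h4, rotate_smul]

theorem gradSq_smul (t : ℂ) (u : H1 m) : gradSq (t • u) = ‖t‖ ^ 2 * gradSq u := by
  rw [gradSq, gradSq, Finset.mul_sum]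
  refine Finset.sum_congr rfl fun j _ => ?_
  have : partialDeriv (t • u) j = t • partialDeriv u j := rfl
  rw [this, norm_smul, mul_pow]

theorem norm_sq_toL2_smul (t : ℂ) (u : H1 m) : ‖toL2 (t • u)‖ ^ 2 = ‖t‖ ^ 2 * ‖toL2 u‖ ^ 2 := by
  have : toL2 (t • u) = t • toL2 u := rfl
  rw [this, norm_smul, mul_pow]

theorem density_smul (t : ℂ) (u : H1 m) :
    density (t • u) =ᵐ[volume] fun x => ‖t‖ ^ 2 * density u x := by
  have h : (toL2 (t • u) : E3 → Cm m) =ᵐ[volume] t • toL2 u := Lp.coeFn_smul t (toL2 u)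
  filter_upwards [h] with x hx
  simp only [density]
  rw [hx, Pi.smul_apply, norm_smul, mul_pow]

theorem newtonPotential_congr {n n' : E3 → ℝ} (h : n =ᵐ[volume] n') :
    newtonPotential n = newtonPotential n' := by
  ext x
  refine integral_congr_ae ?_
  filter_upwards [h] with y hy
  rw [hy]

theorem selfGravity_congr {n n' : E3 → ℝ} (h : n =ᵐ[volume] n') :
    selfGravity n = selfGravity n' := by
  rw [selfGravity_eq, selfGravity_eq, newtonPotential_congr h]
  congr 1
  refine integral_congr_ae ?_
  filter_upwards [h] with y hy
  rw [hy]

theorem external_congr (V : E3 → ℝ) {n n' : E3 → ℝ} (h : n =ᵐ[volume] n') :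
    external V n = external V n' := by
  rw [external, external]
  congr 1
  refine integral_congr_ae ?_
  filter_upwards [h] with y hy
  rw [hy]

theorem newtonPotential_const_mul (c : ℝ) (n : E3 → ℝ) (x : E3) :
    newtonPotential (fun y => c * n y) x = c * newtonPotential n x := by
  simp only [newtonPotential, mul_div_assoc, integral_const_mul]

theorem selfGravity_const_mul (c : ℝ) (n : E3 → ℝ) :
    selfGravity (fun y => c * n y) = c ^ 2 * selfGravity n := by
  rw [selfGravity_eq, selfGravity_eq]
  simp only [newtonPotential_const_mul]
  have : ∀ x, c * n x * (c * newtonPotential n x) = c ^ 2 * (n x * newtonPotential n x) :=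
    fun x => by ring
  simp only [this, integral_const_mul]
  ring

theorem external_const_mul (V : E3 → ℝ) (c : ℝ) (n : E3 → ℝ) :
    external V (fun y => c * n y) = c * external V n := by
  rw [external, external]
  have : ∀ x, -V x * (c * n x) = c * (-V x * n x) := fun x => by ring
  simp only [this, integral_const_mul]
  ring

theorem energy_smul (V : E3 → ℝ) (t : ℂ) (u : H1 m) :
    energy V (t • u) = ‖t‖ ^ 2 * kinetic u - ‖t‖ ^ 2 * external V (density u)
      - ‖t‖ ^ 4 * selfGravity (density u) := by
  rw [energy, external_congr V (density_smul t u), selfGravity_congr (density_smul t u),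
    external_const_mul, selfGravity_const_mul, kinetic_eq, kinetic_eq, gradSq_smul]
  ring

theorem newtonPotential_dilation {l : ℝ} (hl : 0 < l) (n : E3 → ℝ) (x : E3) :
    newtonPotential (fun y => n (l • y)) x = (l ^ 2)⁻¹ * newtonPotential n (l • x) := by
  have e : ∀ y, n (l • y) / ‖x - y‖ = l * (n (l • y) / ‖l • x - l • y‖) := by
    intro y
    rw [← smul_sub, norm_smul, Real.norm_of_nonneg hl.le]
    field_simp
  simp only [newtonPotential, e, integral_const_mul]
  rw [integral_comp_dilation hl (fun y => n y / ‖l • x - y‖), smul_eq_mul]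
  field_simp

theorem selfGravity_dilation {l : ℝ} (hl : 0 < l) (n : E3 → ℝ) :
    selfGravity (fun y => n (l • y)) = (l ^ 5)⁻¹ * selfGravity n := by
  rw [selfGravity_eq, selfGravity_eq]
  simp only [newtonPotential_dilation hl, mul_left_comm _ (l ^ 2)⁻¹, integral_const_mul]
  rw [integral_comp_dilation hl (fun y => n y * newtonPotential n y), smul_eq_mul]
  field_simp

/-- The mass preserving dilation `x ↦ l^{3/2} u(l x)` on `H¹_ρ`. -/
theorem exists_dilation {D : SO3 →* Matrix.unitaryGroup (Fin m) ℂ} (u : H1rho D) {l : ℝ}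
    (hl : 0 < l) : ∃ v : H1rho D, ‖toL2 (toH1 v)‖ ^ 2 = ‖toL2 (toH1 u)‖ ^ 2 ∧
      kinetic (toH1 v) = l ^ 2 * kinetic (toH1 u) ∧
      selfGravity (density (toH1 v)) = l * selfGravity (density (toH1 u)) := by
  let p : Pairs m := WithLp.toLp 2 (dilate l hl.ne' (toL2 (toH1 u)),
    WithLp.toLp 2 fun j => (l : ℂ) • dilate l hl.ne' (partialDeriv (toH1 u) j))
  have hp : p ∈ H1rho D := by
    refine ⟨isWeakGradient_dilate hl (weakGradient (toH1 u)), fun R => ?_⟩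
    change rho D R (dilate l hl.ne' (toL2 (toH1 u))) = dilate l hl.ne' (toL2 (toH1 u))
    rw [rho_dilate]
    congr 1
    exact u.2.2 R
  let w : H1rho D := ⟨p, hp⟩
  let t : ℂ := (Real.sqrt (l ^ 3) : ℝ)
  have ht : ‖t‖ ^ 2 = l ^ 3 := by
    rw [Complex.norm_real, Real.norm_eq_abs, sq_abs, Real.sq_sqrt (by positivity)]
  have hmass : ‖toL2 (toH1 w)‖ ^ 2 = (l ^ 3)⁻¹ * ‖toL2 (toH1 u)‖ ^ 2 :=
    norm_sq_dilate hl (toL2 (toH1 u))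
  have hgrad : gradSq (toH1 w) = l ^ 2 * ((l ^ 3)⁻¹ * gradSq (toH1 u)) := by
    simp only [gradSq, Finset.mul_sum]
    refine Finset.sum_congr rfl fun j _ => ?_
    rw [← norm_sq_dilate hl]
    have : partialDeriv (toH1 w) j = (l : ℂ) • dilate l hl.ne' (partialDeriv (toH1 u) j) := rfl
    rw [this, norm_smul, mul_pow, Complex.norm_real, Real.norm_eq_abs, sq_abs]
  have hdens : density (toH1 w) =ᵐ[volume] fun x => density (toH1 u) (l • x) := by
    have h : (toL2 (toH1 w) : E3 → Cm m) =ᵐ[volume] fun x => toL2 (toH1 u) (l • x) :=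
      coeFn_dilate hl.ne' _
    filter_upwards [h] with x hx
    simp only [density]
    rw [hx]
  have hsm : toH1 (t • w) = t • toH1 w := rfl
  refine ⟨t • w, ?_, ?_, ?_⟩
  · rw [hsm, norm_sq_toL2_smul, ht, hmass]; field_simp
  · rw [hsm, kinetic_eq, gradSq_smul, ht, hgrad, kinetic_eq]; field_simp
  · rw [hsm, selfGravity_congr (density_smul t _), selfGravity_const_mul, ht,
      selfGravity_congr hdens, selfGravity_dilation hl]
    field_simp

theorem newtonPotential_pos {u : H1 m} (hu : 0 < ‖toL2 u‖) (x : E3) :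
    0 < newtonPotential (density u) x := by
  obtain ⟨δ, -, h⟩ := exists_newtonPotential_le one_pos
  have hi := (h _ (integrable_density u) (memLp_density u) (density_nonneg u) x).1
  refine lt_of_le_of_ne (newtonPotential_nonneg (density_nonneg u) x) fun h0 => ?_
  have h1 := (integral_eq_zero_iff_of_nonneg
    (fun y => div_nonneg (density_nonneg u y) (norm_nonneg _)) hi).1 h0.symm
  have h2 : density u =ᵐ[volume] 0 := by
    -- The point `y = x` has to be excluded: there the quotient is zero by convention and says
    -- nothing about the density.
    filter_upwards [h1, Measure.ae_ne volume x] with y hy hyx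
    have : ‖x - y‖ ≠ 0 := by
      rw [norm_ne_zero_iff, sub_ne_zero]; exact hyx.symm
    simpa [this] using hy
  have h3 := integral_density u
  rw [integral_congr_ae h2] at h3
  simp at h3
  exact hu.ne' (by simpa using h3.symm)

theorem selfGravity_density_pos {u : H1 m} (hu : 0 < ‖toL2 u‖) : 0 < selfGravity (density u) := by
  rw [selfGravity_eq]
  refine mul_pos (by positivity) (lt_of_le_of_ne (integral_nonneg fun x =>
    mul_nonneg (density_nonneg u x) (newtonPotential_pos hu x).le) fun h0 => ?_)
  have h1 := (integral_eq_zero_iff_of_nonneg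
    (fun x => mul_nonneg (density_nonneg u x) (newtonPotential_pos hu x).le)
    (integrable_mul_newtonPotential (integrable_density u) u)).1 h0.symm
  have h2 : density u =ᵐ[volume] 0 := by
    filter_upwards [h1] with y hy
    simpa [(newtonPotential_pos hu y).ne'] using hy
  have h3 := integral_density u
  rw [integral_congr_ae h2] at h3
  simp at h3
  exact hu.ne' (by simpa using h3.symm)

/-- Needed for the real `sInf` in `minEnergy` to be a genuine lower bound. -/
theorem bddBelow_energy (D : SO3 →* Matrix.unitaryGroup (Fin m) ℂ) {V : E3 → ℝ}
    (hVmeas : AEMeasurable V volume)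
    (hVloc : ∀ K : Set E3, IsCompact K → MemLp V 2 (volume.restrict K))
    (hVlim : Tendsto V (cocompact E3) (𝓝 0)) (hVneg : ∀ x, V x ≤ 0) {N : ℝ} (hN : 0 < N) :
    BddBelow ((fun u : H1rho D => energy V (toH1 u)) '' admissible D N) := by
  obtain ⟨C, hC⟩ := exists_gradSq_le_energy (m := m) hVmeas hVloc hVlim hVneg hN
  refine ⟨-C, ?_⟩
  rintro _ ⟨u, hu, rfl⟩
  have h1 := hC (toH1 u) hu
  have h2 := gradSq_nonneg (toH1 u)
  change -C ≤ energy V (toH1 u)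
  linarith

theorem minEnergy_neg {D : SO3 →* Matrix.unitaryGroup (Fin m) ℂ} {V : E3 → ℝ}
    (hVneg : ∀ x, V x ≤ 0) {N : ℝ} (hN : 0 < N)
    (hbdd : BddBelow ((fun u : H1rho D => energy V (toH1 u)) '' admissible D N))
    (hne : (admissible D N).Nonempty) : minEnergy D V N < 0 := by
  obtain ⟨u, hu⟩ := hne
  have hu' : ‖toL2 (toH1 u)‖ ^ 2 = N := hu
  have hu0 : 0 < ‖toL2 (toH1 u)‖ := by
    refine lt_of_le_of_ne (norm_nonneg _) fun h => ?_
    rw [← h] at hu'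
    norm_num at hu'
    exact hN.ne hu'
  have hD := selfGravity_density_pos hu0
  set d := selfGravity (density (toH1 u)) with hd
  have hT : 0 ≤ kinetic (toH1 u) := by
    rw [kinetic_eq]; exact mul_nonneg (by norm_num) (gradSq_nonneg _)
  set T := kinetic (toH1 u) with hTdef
  -- The dilation factor `l = d / (T + 1)` is small enough that `l² T < l d`.
  have hl : 0 < d / (T + 1) := by positivity
  obtain ⟨v, hv1, hv2, hv3⟩ := exists_dilation u hl
  have hv : v ∈ admissible D N := hv1.trans hu'
  refine (csInf_le hbdd ⟨v, hv, rfl⟩).trans_lt ?_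
  change energy V (toH1 v) < 0
  rw [energy, hv2, hv3]
  have h1 := external_nonneg hVneg (toH1 v)
  have h2 : (d / (T + 1)) ^ 2 * T < d / (T + 1) * d := by
    rw [sq, mul_assoc]
    refine mul_lt_mul_of_pos_left ?_ hl
    rw [div_mul_eq_mul_div, div_lt_iff₀ (by positivity)]
    nlinarith
  linarith

/-! ### Weak and strong sequential compactness -/

/-- Bounded sequences in a separable Hilbert space have weakly convergent subsequences. -/
theorem exists_subseq_weakly_tendsto {H : Type*} [NormedAddCommGroup H] [InnerProductSpace ℂ H]
    [CompleteSpace H] [TopologicalSpace.SeparableSpace H] {x : ℕ → H} {M : ℝ}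
    (hx : ∀ k, ‖x k‖ ≤ M) :
    ∃ (a : H) (φ : ℕ → ℕ), StrictMono φ ∧
      ∀ f : StrongDual ℂ H, Tendsto (fun k => f (x (φ k))) atTop (𝓝 (f a)) := by
  -- The Riesz map transfers the sequence to the dual, where sequential Banach–Alaoglu applies. It
  -- is conjugate linear, hence the conjugation in the limit below.
  let y : ℕ → WeakDual ℂ H := fun k =>
    StrongDual.toWeakDual (InnerProductSpace.toDual ℂ H (x k))
  have hy : ∀ k, y k ∈ WeakDual.toStrongDual ⁻¹' Metric.closedBall (0 : StrongDual ℂ H) M := by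
    intro k
    change InnerProductSpace.toDual ℂ H (x k) ∈ Metric.closedBall (0 : StrongDual ℂ H) M
    rw [mem_closedBall_zero_iff, LinearIsometryEquiv.norm_map]
    exact hx k
  obtain ⟨f₀, -, φ, hφ, hlim⟩ := WeakDual.isSeqCompact_closedBall ℂ H 0 M hy
  rw [tendsto_iff_forall_eval_tendsto_topDualPairing] at hlim
  refine ⟨(InnerProductSpace.toDual ℂ H).symm (WeakDual.toStrongDual f₀), φ, hφ, fun f => ?_⟩
  set z := (InnerProductSpace.toDual ℂ H).symm f with hz
  have hf : ∀ v, f v = inner ℂ z v := fun v => InnerProductSpace.toDual_symm_apply.symm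
  have h1 : Tendsto (fun k => inner ℂ (x (φ k)) z) atTop (𝓝 (WeakDual.toStrongDual f₀ z)) :=
    hlim z
  have h2 := (Complex.continuous_conj.tendsto _).comp h1
  have h3 : (starRingEnd ℂ) (WeakDual.toStrongDual f₀ z)
      = f ((InnerProductSpace.toDual ℂ H).symm (WeakDual.toStrongDual f₀)) := by
    rw [hf, ← inner_conj_symm, InnerProductSpace.toDual_symm_apply]
  rw [h3] at h2
  refine h2.congr fun k => ?_
  rw [hf, Function.comp_apply, inner_conj_symm]

/-- Along some subsequence `k` is strictly increasing or nonincreasing, and in the latter case it is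
constant once it attains its minimum. This handles indices picked by approximation, which come in no
particular order. -/
theorem exists_strictMono_comp_or_const (k : ℕ → ℕ) : ∃ g : ℕ → ℕ, StrictMono g ∧
    (StrictMono (k ∘ g) ∨ ∃ c, ∀ n, k (g n) = c) := by
  obtain ⟨g, hg⟩ := exists_increasing_or_nonincreasing_subseq (· < ·) k
  rcases hg with hg | hg
  · exact ⟨g, g.strictMono, Or.inl fun m n h => hg m n h⟩
  · obtain ⟨n₀, hn₀⟩ : sInf (Set.range (k ∘ g)) ∈ Set.range (k ∘ g) :=
      Nat.sInf_mem (Set.range_nonempty _)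
    refine ⟨fun n => g (n₀ + 1 + n), fun a b h => g.strictMono (by omega), Or.inr ⟨k (g n₀), fun n => ?_⟩⟩
    refine le_antisymm (not_lt.1 (hg n₀ _ (by omega))) ?_
    have : sInf (Set.range (k ∘ g)) ≤ (k ∘ g) (n₀ + 1 + n) := Nat.sInf_le ⟨_, rfl⟩
    rw [← hn₀] at this
    exact this

/-- A sequence all of whose subsequences have convergent subsequences has relatively compact
range. -/
theorem isCompact_closure_range_of_subseq {X : Type*} [MetricSpace X] {u : ℕ → X}
    (h : ∀ ψ : ℕ → ℕ, StrictMono ψ → ∃ (φ : ℕ → ℕ) (a : X), StrictMono φ ∧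
      Tendsto (fun n => u (ψ (φ n))) atTop (𝓝 a)) :
    IsCompact (closure (Set.range u)) := by
  refine IsSeqCompact.isCompact fun v hv => ?_
  have hnear : ∀ i : ℕ, ∃ k, dist (v i) (u k) < 1 / ((i : ℝ) + 1) := fun i => by
    obtain ⟨_, ⟨k, rfl⟩, hk⟩ := Metric.mem_closure_iff.1 (hv i) (1 / ((i : ℝ) + 1)) (by positivity)
    exact ⟨k, hk⟩
  choose k hk using hnear
  obtain ⟨g, hg, hcase⟩ := exists_strictMono_comp_or_const k
  obtain ⟨φ, a, hφ, ha⟩ : ∃ (φ : ℕ → ℕ) (a : X), StrictMono φ ∧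
      Tendsto (fun n => u (k (g (φ n)))) atTop (𝓝 a) := by
    rcases hcase with hc | ⟨c, hc⟩
    · exact h _ hc
    · exact ⟨id, u c, strictMono_id, by simp only [hc]; exact tendsto_const_nhds⟩
  have hlim : Tendsto (fun n => v (g (φ n))) atTop (𝓝 a) := by
    refine ha.congr_dist ?_
    have h0 : Tendsto (fun n => 1 / (((g (φ n) : ℕ) : ℝ) + 1)) atTop (𝓝 0) :=
      tendsto_one_div_add_atTop_nhds_zero_nat.comp (hg.comp hφ).tendsto_atTop
    refine squeeze_zero (fun _ => dist_nonneg) (fun n => ?_) h0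
    rw [dist_comm]
    exact (hk _).le
  exact ⟨a, mem_closure_of_tendsto hlim (Eventually.of_forall fun n => hv _) |> fun h' => by
    rwa [closure_closure] at h', g ∘ φ, hg.comp hφ, hlim⟩

/-! ### `H¹_ρ` as a separable Hilbert space -/

theorem continuous_integral_smul {φ : E3 → ℝ} (hc : Continuous φ) (hs : HasCompactSupport φ) :
    Continuous fun u : L2 m => ∫ x, φ x • u x := by
  have hφ : MemLp φ 2 (volume : Measure E3) := hc.memLp_of_hasCompactSupport hs
  have h := (ContinuousLinearMap.lpPairing (volume : Measure E3) 2 2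
    (ContinuousLinearMap.lsmul ℝ ℝ : ℝ →L[ℝ] Cm m →L[ℝ] Cm m) hφ.toLp).continuous
  refine h.congr fun u => ?_
  rw [ContinuousLinearMap.lpPairing_eq_integral]
  refine integral_congr_ae ?_
  filter_upwards [hφ.coeFn_toLp] with x hx
  rw [hx]
  rfl

theorem norm_rho_le (D : SO3 →* Matrix.unitaryGroup (Fin m) ℂ) (R : SO3) (u : L2 m) :
    ‖rho D R u‖ ≤ ‖u‖ := by
  have h := Lp.norm_compMeasurePreserving u (measurePreserving_rotate R⁻¹)
  rw [← h]
  refine Lp.norm_le_norm_of_ae_le ?_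
  filter_upwards [ContinuousLinearMap.coeFn_compLp (valueAction D R)
    (Lp.compMeasurePreserving (rotate R⁻¹) (measurePreserving_rotate R⁻¹) u)] with x hx
  have hx' : (rho D R u) x = valueAction D R
    ((Lp.compMeasurePreserving (rotate R⁻¹) (measurePreserving_rotate R⁻¹) u) x) := hx
  rw [hx', norm_valueAction]

theorem continuous_rho (D : SO3 →* Matrix.unitaryGroup (Fin m) ℂ) (R : SO3) :
    Continuous (rho D R) :=
  AddMonoidHomClass.continuous_of_bound (rho D R) 1 fun u => by
    rw [one_mul]; exact norm_rho_le D R u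

/-- Both the weak gradient identities and the invariance are equalities between continuous functions
of the pair. Closedness gives the completeness that the Riesz map requires. -/
theorem isClosed_H1rho (D : SO3 →* Matrix.unitaryGroup (Fin m) ℂ) :
    IsClosed (H1rho D : Set (Pairs m)) := by
  have hfst : Continuous fun p : Pairs m => p.fst := WithLp.continuous_fst 2 _ _
  have hsnd : ∀ j, Continuous fun p : Pairs m => p.snd j := fun j =>
    (PiLp.continuous_apply 2 _ j).comp (WithLp.continuous_snd 2 _ _)
  have h : (H1rho D : Set (Pairs m)) =
      {p | ∀ φ : E3 → ℝ, ContDiff ℝ ∞ φ → HasCompactSupport φ → ∀ j : Fin 3,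
        ∫ x, (fderiv ℝ φ x (EuclideanSpace.single j 1)) • (p.fst x) = - ∫ x, φ x • (p.snd j x)}
      ∩ {p | ∀ R : SO3, rho D R p.fst = p.fst} := rfl
  rw [h]
  refine IsClosed.inter ?_ ?_
  · simp only [Set.ofPred_forall]
    refine isClosed_iInter fun φ => isClosed_iInter fun hφ => isClosed_iInter fun hs =>
      isClosed_iInter fun j => isClosed_eq ?_ ?_
    · exact (continuous_integral_smul
        ((hφ.continuous_fderiv (by simp)).clm_apply continuous_const)
        (hs.fderiv_apply (𝕜 := ℝ) (v := EuclideanSpace.single j 1))).comp hfst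
    · exact ((continuous_integral_smul hφ.continuous hs).comp (hsnd j)).neg
  · simp only [Set.ofPred_forall]
    exact isClosed_iInter fun R => isClosed_eq ((continuous_rho D R).comp hfst) hfst

instance (D : SO3 →* Matrix.unitaryGroup (Fin m) ℂ) : CompleteSpace (H1rho D) :=
  (isClosed_H1rho D).completeSpace_coe

instance (D : SO3 →* Matrix.unitaryGroup (Fin m) ℂ) :
    TopologicalSpace.SeparableSpace (H1rho D) := by
  have : Fact ((2 : ℝ≥0∞) ≠ ⊤) := ⟨by norm_num⟩
  have : SecondCountableTopology (L2 m) := Lp.SecondCountableTopology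
  have : SecondCountableTopology (PiLp 2 fun _ : Fin 3 => L2 m) :=
    (PiLp.homeomorph 2 fun _ : Fin 3 => L2 m).secondCountableTopology
  have : SecondCountableTopology (Pairs m) :=
    (WithLp.homeomorphProd 2 (L2 m) (PiLp 2 fun _ : Fin 3 => L2 m)).secondCountableTopology
  infer_instance

/-! ### Weak lower semicontinuity and weak-to-strong convergence -/

variable {D : SO3 →* Matrix.unitaryGroup (Fin m) ℂ}

/-- The inclusion `H¹_ρ → L²` as a continuous linear map. -/
def toL2CLM (D : SO3 →* Matrix.unitaryGroup (Fin m) ℂ) : H1rho D →L[ℂ] L2 m :=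
  LinearMap.mkContinuous
    { toFun := fun u => toL2 (toH1 u), map_add' := fun _ _ => rfl, map_smul' := fun _ _ => rfl } 1
    fun u => by
      rw [one_mul]
      exact le_of_sq_le_sq (mass_le_norm_sq (toH1 u)) (norm_nonneg _)

/-- The weak partial derivative `H¹_ρ → L²` as a continuous linear map. -/
def partialCLM (D : SO3 →* Matrix.unitaryGroup (Fin m) ℂ) (j : Fin 3) : H1rho D →L[ℂ] L2 m :=
  LinearMap.mkContinuous
    { toFun := fun u => partialDeriv (toH1 u) j, map_add' := fun _ _ => rfl,
      map_smul' := fun _ _ => rfl } 1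
    fun u => by
      rw [one_mul]
      refine le_of_sq_le_sq ?_ (norm_nonneg _)
      have h1 := norm_sq_eq (toH1 u)
      have h2 : ‖partialDeriv (toH1 u) j‖ ^ 2 ≤ gradSq (toH1 u) :=
        Finset.single_le_sum (f := fun j => ‖partialDeriv (toH1 u) j‖ ^ 2)
          (fun _ _ => by positivity) (Finset.mem_univ j)
      change ‖partialDeriv (toH1 u) j‖ ^ 2 ≤ ‖toH1 u‖ ^ 2
      have h3 : 0 ≤ ‖toL2 (toH1 u)‖ ^ 2 := by positivity
      linarith

theorem tendsto_inner_of_weak {L : H1rho D →L[ℂ] L2 m} {u : ℕ → H1rho D} {v : H1rho D}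
    (h : ∀ f : StrongDual ℂ (H1rho D), Tendsto (fun k => f (u k)) atTop (𝓝 (f v))) (w : L2 m) :
    Tendsto (fun k => inner ℂ w (L (u k))) atTop (𝓝 (inner ℂ w (L v))) :=
  h ((innerSL ℂ w).comp L)

/-- An affine minorant of the squared norm, exact at `y = x`. Unlike the norm it passes to weak
limits, which gives lower semicontinuity with no `liminf`. -/
theorem two_re_inner_sub_le {H : Type*} [NormedAddCommGroup H] [InnerProductSpace ℂ H] (x y : H) :
    2 * (inner ℂ x y).re - ‖x‖ ^ 2 ≤ ‖y‖ ^ 2 := by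
  have h := norm_sub_sq (𝕜 := ℂ) x y
  have h2 : 0 ≤ ‖x - y‖ ^ 2 := by positivity
  have h3 : RCLike.re (inner ℂ x y) = (inner ℂ x y).re := rfl
  rw [h3] at h
  linarith

theorem tendsto_two_re_inner_sub {H : Type*} [NormedAddCommGroup H] [InnerProductSpace ℂ H]
    {x : H} {y : ℕ → H} (h : Tendsto (fun k => inner ℂ x (y k)) atTop (𝓝 (inner ℂ x x))) :
    Tendsto (fun k => 2 * (inner ℂ x (y k)).re - ‖x‖ ^ 2) atTop (𝓝 (‖x‖ ^ 2)) := by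
  have h1 := (((Complex.continuous_re.tendsto _).comp h).const_mul 2).sub_const (‖x‖ ^ 2)
  have h2 : 2 * (inner ℂ x x).re - ‖x‖ ^ 2 = ‖x‖ ^ 2 := by
    have : (inner ℂ x x).re = ‖x‖ ^ 2 := (norm_sq_eq_re_inner (𝕜 := ℂ) x).symm
    rw [this]; ring
  rw [h2] at h1
  exact h1

theorem gradSq_le_of_weak {u : ℕ → H1rho D} {v : H1rho D} {τ : ℝ}
    (h : ∀ f : StrongDual ℂ (H1rho D), Tendsto (fun k => f (u k)) atTop (𝓝 (f v)))
    (hτ : Tendsto (fun k => gradSq (toH1 (u k))) atTop (𝓝 τ)) : gradSq (toH1 v) ≤ τ := by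
  have hl : Tendsto (fun k => ∑ j, (2 * (inner ℂ (partialDeriv (toH1 v) j)
      (partialDeriv (toH1 (u k)) j)).re - ‖partialDeriv (toH1 v) j‖ ^ 2)) atTop
      (𝓝 (gradSq (toH1 v))) :=
    tendsto_finsetSum _ fun j _ => tendsto_two_re_inner_sub
      (tendsto_inner_of_weak (L := partialCLM D j) h (partialDeriv (toH1 v) j))
  exact le_of_tendsto_of_tendsto' hl hτ fun k =>
    Finset.sum_le_sum fun j _ => two_re_inner_sub_le _ _

/-- Expand `‖u k - v‖²`: the cross term converges by weak convergence. -/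
theorem tendsto_of_weak_of_norm {H : Type*} [NormedAddCommGroup H] [InnerProductSpace ℂ H]
    {u : ℕ → H} {v : H} (h : ∀ f : StrongDual ℂ H, Tendsto (fun k => f (u k)) atTop (𝓝 (f v)))
    (hn : Tendsto (fun k => ‖u k‖ ^ 2) atTop (𝓝 (‖v‖ ^ 2))) : Tendsto u atTop (𝓝 v) := by
  have h1 := tendsto_two_re_inner_sub (h (innerSL ℂ v))
  have h2 := hn.sub h1
  rw [sub_self] at h2
  have h3 : Tendsto (fun k => ‖u k - v‖ ^ 2) atTop (𝓝 0) := by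
    refine h2.congr fun k => ?_
    rw [norm_sub_rev, norm_sub_sq (𝕜 := ℂ) v (u k)]
    have h3 : RCLike.re (inner ℂ v (u k)) = (inner ℂ v (u k)).re := rfl
    rw [h3]
    change _ - (2 * (inner ℂ v (u k)).re - ‖v‖ ^ 2) = _
    ring
  have h4 := h3.sqrt
  simp only [Real.sqrt_sq (norm_nonneg _), Real.sqrt_zero] at h4
  exact tendsto_iff_norm_sub_tendsto_zero.2 h4

/-! ### Minimizing sequences -/

section Main

variable {V : E3 → ℝ} {N : ℝ}

theorem exists_norm_le_of_isMinimizingSeq (hVmeas : AEMeasurable V volume)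
    (hVloc : ∀ K : Set E3, IsCompact K → MemLp V 2 (volume.restrict K))
    (hVlim : Tendsto V (cocompact E3) (𝓝 0)) (hVneg : ∀ x, V x ≤ 0) (hN : 0 < N)
    {u : ℕ → H1rho D} (hu : IsMinimizingSeq D V N u) : ∃ M, ∀ k, ‖u k‖ ≤ M := by
  obtain ⟨C, hC⟩ := exists_gradSq_le_energy (m := m) hVmeas hVloc hVlim hVneg hN
  obtain ⟨B, hB⟩ := hu.2.bddAbove_range
  refine ⟨Real.sqrt (N + 4 * (B + C)), fun k => Real.le_sqrt_of_sq_le ?_⟩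
  have h1 := hC (toH1 (u k)) (hu.1 k)
  have h2 : energy V (toH1 (u k)) ≤ B := hB ⟨k, rfl⟩
  have h3 := norm_sq_eq (toH1 (u k))
  have h4 : ‖toL2 (toH1 (u k))‖ ^ 2 = N := hu.1 k
  change ‖toH1 (u k)‖ ^ 2 ≤ _
  linarith

/-- Excludes a vanishing weak limit, so that dividing by its mass is legitimate. -/
theorem energy_nonneg_of_norm_eq_zero (V : E3 → ℝ) {u : H1 m} (hu : ‖toL2 u‖ = 0) :
    0 ≤ energy V u := by
  have h0 : density u =ᵐ[volume] fun _ => 0 := by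
    refine (integral_eq_zero_iff_of_nonneg (density_nonneg u) (integrable_density u)).1 ?_
    rw [integral_density, hu]; norm_num
  have h1 : external V (density u) = 0 := by rw [external_congr V h0]; simp [external]
  have h2 : selfGravity (density u) = 0 := by rw [selfGravity_congr h0]; simp [selfGravity]
  rw [energy, h1, h2, kinetic_eq]
  linarith [gradSq_nonneg u]

/-- Rescaling the amplitude shows that a state of negative energy no larger than the ground state
energy has at least the prescribed mass. -/
theorem le_norm_sq_of_energy_le
    (hbdd : BddBelow ((fun u : H1rho D => energy V (toH1 u)) '' admissible D N))
    {u : H1rho D} (hneg : energy V (toH1 u) < 0)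
    (hle : energy V (toH1 u) ≤ minEnergy D V N) : N ≤ ‖toL2 (toH1 u)‖ ^ 2 := by
  by_contra! hlt
  have hpos : 0 < ‖toL2 (toH1 u)‖ := by
    refine lt_of_le_of_ne (norm_nonneg _) fun h => ?_
    exact absurd hneg (not_lt.2 (energy_nonneg_of_norm_eq_zero V h.symm))
  have hpos2 : 0 < ‖toL2 (toH1 u)‖ ^ 2 := by positivity
  set s := N / ‖toL2 (toH1 u)‖ ^ 2 with hs
  have hs1 : 1 < s := by rwa [hs, one_lt_div hpos2]
  let t : ℂ := (Real.sqrt s : ℝ)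
  have ht : ‖t‖ ^ 2 = s := by
    rw [Complex.norm_real, Real.norm_eq_abs, sq_abs, Real.sq_sqrt (by positivity)]
  have hadm : t • u ∈ admissible D N := by
    change ‖toL2 (t • toH1 u)‖ ^ 2 = N
    rw [norm_sq_toL2_smul, ht, hs]; field_simp
  have hmin : minEnergy D V N ≤ energy V (t • toH1 u) := csInf_le hbdd ⟨t • u, hadm, rfl⟩
  have ht4 : ‖t‖ ^ 4 = s ^ 2 := by rw [← ht]; ring
  rw [energy_smul, ht, ht4] at hmin
  have hD := selfGravity_density_pos hpos
  have hE : energy V (toH1 u) = kinetic (toH1 u) - external V (density (toH1 u))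
    - selfGravity (density (toH1 u)) := rfl
  rw [hE] at hneg hle
  -- The rescaled energy is `s E - (s² - s) G`, which is below `E` because `s > 1`, `E < 0` and `G >
  -- 0`.
  nlinarith [mul_pos (sub_pos.2 hs1) (neg_pos.2 hneg),
    mul_pos (mul_pos (sub_pos.2 hs1) (zero_lt_one.trans hs1)) hD]

/-- The weak limit of a minimizing sequence is a minimizer and a strong limit. -/
theorem minimizer_of_weak_limit (hVmeas : AEMeasurable V volume)
    (hVloc : ∀ K : Set E3, IsCompact K → MemLp V 2 (volume.restrict K))
    (hVlim : Tendsto V (cocompact E3) (𝓝 0)) (hVneg : ∀ x, V x ≤ 0) (hN : 0 < N)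
    {u : ℕ → H1rho D} {v : H1rho D} (hu : IsMinimizingSeq D V N u)
    (h : ∀ f : StrongDual ℂ (H1rho D), Tendsto (fun k => f (u k)) atTop (𝓝 (f v))) :
    v ∈ admissible D N ∧ energy V (toH1 v) = minEnergy D V N ∧ Tendsto u atTop (𝓝 v) := by
  obtain ⟨M, hM⟩ := exists_norm_le_of_isMinimizingSeq hVmeas hVloc hVlim hVneg hN hu
  have hbdd := bddBelow_energy D hVmeas hVloc hVlim hVneg hN
  have hneg : minEnergy D V N < 0 := minEnergy_neg hVneg hN hbdd ⟨u 0, hu.1 0⟩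
  have hweak : ∀ w : L2 m, Tendsto (fun k => inner ℂ w (toL2 (toH1 (u k)))) atTop
      (𝓝 (inner ℂ w (toL2 (toH1 v)))) := tendsto_inner_of_weak (L := toL2CLM D) h
  have hMk : ∀ k, ‖toH1 (u k)‖ ≤ M := hM
  have hL := tendsto_external hVmeas hVloc hVlim hVneg hMk hweak
  have hG := tendsto_selfGravity hMk hweak
  set L := external V (density (toH1 v)) with hLdef
  set G := selfGravity (density (toH1 v)) with hGdef
  -- Total energy and both attractive terms converge, so the kinetic energies do too. Once the limit
  -- is known to be a minimizer, their limit is its own kinetic energy, and the `H¹` norms converge.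
  have hgrad : Tendsto (fun k => gradSq (toH1 (u k))) atTop
      (𝓝 (2 * (minEnergy D V N + L + G))) := by
    refine (((hu.2.add hL).add hG).const_mul 2).congr fun k => ?_
    rw [energy, kinetic_eq]; ring
  have hgv := gradSq_le_of_weak h hgrad
  have hE : energy V (toH1 v) = (1 / 2) * gradSq (toH1 v) - L - G := by
    rw [energy, kinetic_eq]
  have hEle : energy V (toH1 v) ≤ minEnergy D V N := by rw [hE]; linarith
  have hmass_le : ‖toL2 (toH1 v)‖ ^ 2 ≤ N := by
    refine le_of_tendsto' (tendsto_two_re_inner_sub (hweak (toL2 (toH1 v)))) fun k => ?_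
    have h1 : ‖toL2 (toH1 (u k))‖ ^ 2 = N := hu.1 k
    exact (two_re_inner_sub_le _ _).trans_eq h1
  have hmass : ‖toL2 (toH1 v)‖ ^ 2 = N :=
    le_antisymm hmass_le (le_norm_sq_of_energy_le hbdd (hEle.trans_lt hneg) hEle)
  have hadm : v ∈ admissible D N := hmass
  have hEeq : energy V (toH1 v) = minEnergy D V N :=
    le_antisymm hEle (csInf_le hbdd ⟨v, hadm, rfl⟩)
  refine ⟨hadm, hEeq, tendsto_of_weak_of_norm h ?_⟩
  have h1 : 2 * (minEnergy D V N + L + G) = gradSq (toH1 v) := by rw [← hEeq, hE]; ring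
  rw [h1] at hgrad
  have h2 : ∀ w : H1rho D, ‖w‖ ^ 2 = ‖toL2 (toH1 w)‖ ^ 2 + gradSq (toH1 w) := fun w =>
    norm_sq_eq (toH1 w)
  rw [h2 v, hmass]
  refine (hgrad.const_add N).congr fun k => ?_
  have h3 : ‖toL2 (toH1 (u k))‖ ^ 2 = N := hu.1 k
  rw [h2, h3]

theorem isMinimizingSeq_comp {u : ℕ → H1rho D} (hu : IsMinimizingSeq D V N u) {ψ : ℕ → ℕ}
    (hψ : StrictMono ψ) : IsMinimizingSeq D V N (fun k => u (ψ k)) :=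
  ⟨fun k => hu.1 (ψ k), hu.2.comp hψ.tendsto_atTop⟩

theorem isCompact_closure_range_of_isMinimizingSeq (hVmeas : AEMeasurable V volume)
    (hVloc : ∀ K : Set E3, IsCompact K → MemLp V 2 (volume.restrict K))
    (hVlim : Tendsto V (cocompact E3) (𝓝 0)) (hVneg : ∀ x, V x ≤ 0) (hN : 0 < N)
    {u : ℕ → H1rho D} (hu : IsMinimizingSeq D V N u) : IsCompact (closure (Set.range u)) := by
  obtain ⟨M, hM⟩ := exists_norm_le_of_isMinimizingSeq hVmeas hVloc hVlim hVneg hN hu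
  refine isCompact_closure_range_of_subseq fun ψ hψ => ?_
  obtain ⟨v, φ, hφ, hweak⟩ := exists_subseq_weakly_tendsto (x := fun k => u (ψ k))
    fun k => hM (ψ k)
  exact ⟨φ, v, hφ, (minimizer_of_weak_limit hVmeas hVloc hVlim hVneg hN
    (isMinimizingSeq_comp (isMinimizingSeq_comp hu hψ) hφ) hweak).2.2⟩

end Main

end BosonStar

end

theorem theorem4p1 (ℓ : ℕ)
    (D : BosonStar.SO3 →* Matrix.unitaryGroup (Fin (2 * ℓ + 1)) ℂ)
    (hDcont : Continuous D)
    (hDirr : (BosonStar.linearRep D).IsIrreducible)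
    (V : BosonStar.E3 → ℝ)
    (hVmeas : AEMeasurable V volume)
    (hVloc : ∀ K : Set BosonStar.E3, IsCompact K → MemLp V 2 (volume.restrict K))
    (hVlim : Tendsto V (cocompact BosonStar.E3) (𝓝 0))
    (hVneg : ∀ x, V x ≤ 0)
    (N : ℝ) (hN : 0 < N) :
    (∀ (u : ℕ → BosonStar.H1rho D) (uStar : BosonStar.H1rho D),
      BosonStar.IsMinimizingSeq D V N u →
      Tendsto (fun k => toWeakSpace ℂ (BosonStar.H1rho D) (u k)) atTop
        (𝓝 (toWeakSpace ℂ (BosonStar.H1rho D) uStar)) →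
      uStar ∈ BosonStar.admissible D N ∧
      (BosonStar.energy V (BosonStar.toH1 uStar) = BosonStar.minEnergy D V N ∧
        ∀ v ∈ BosonStar.admissible D N,
          BosonStar.energy V (BosonStar.toH1 uStar) ≤
            BosonStar.energy V (BosonStar.toH1 v)) ∧
      Tendsto u atTop (𝓝 uStar)) ∧
    (∀ u : ℕ → BosonStar.H1rho D, BosonStar.IsMinimizingSeq D V N u →
      IsCompact (closure (Set.range u))) := by
  refine ⟨fun u uStar hu hweak => ?_, fun u hu =>
    BosonStar.isCompact_closure_range_of_isMinimizingSeq hVmeas hVloc hVlim hVneg hN hu⟩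
  have h : ∀ f : StrongDual ℂ (BosonStar.H1rho D),
      Tendsto (fun k => f (u k)) atTop (𝓝 (f uStar)) := fun f =>
    ((WeakBilin.eval_continuous (topDualPairing ℂ (BosonStar.H1rho D)).flip f).tendsto _).comp
      hweak
  obtain ⟨hadm, hE, hlim⟩ :=
    BosonStar.minimizer_of_weak_limit hVmeas hVloc hVlim hVneg hN hu h
  refine ⟨hadm, ⟨hE, fun v hv => ?_⟩, hlim⟩
  rw [hE]
  exact csInf_le (BosonStar.bddBelow_energy D hVmeas hVloc hVlim hVneg hN) ⟨v, hv, rfl⟩
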